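/- Let $m,n\ge 1$ be integers. There exists a constant $C>0$ depending only on $m,n$ such that the following holds. Let $\mathbf K$ be a global function field over a finite field $\mathbb F_q$, let $\nu$ be a normalized discrete valuation on $\mathbf K$, let $\mathbf K_\nu$ be the completion of $\mathbf K$ with respect to $\nu$, with valuation ring $\mathcal O_\nu$, let $\pi_\nu\in\mathbf K$ be a uniformizer ($\nu(\pi_\nu)=1$), let $q_\nu=\operatorname{Card}(\mathcal O_\nu/\pi_\nu\mathcal O_\nu)$, and let $|x|=q_\nu^{-\nu(x)}$ for $x\in\mathbf K_\nu$. For $0\le i\le m+n$ equip $\bigwedge^i\mathbf K_\nu^{m+n}$ with the norm $\|\mathbf v\|=\max_I|v_I|$, where $\mathbf v=\sum_I v_I\mathbf e_I$ is the expansion in the standard basis $\mathbf e_I=\mathbf e_{j_1}\wedge\dots\wedge\mathbf e_{j_i}$, $I=\{j_1<\dots<j_i\}\subseteq\{1,\dots,m+n\}$, and let matrices act on it by $g(\mathbf v_1\wedge\dots\wedge\mathbf v_i)=(g\mathbf v_1)\wedge\dots\wedge(g\mathbf v_i)$. For $t\in\mathbb Z$ let $$g_t=\begin{pmatrix}\pi_\nu^{-nt}\mathbf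 I_m & \\ & \pi_\nu^{mt}\mathbf I_n\end{pmatrix},$$ and let $\lambda$ be the normalized Haar measure on the compact group $\operatorname{SL}_{m+n}(\mathcal O_\nu)$. Then for every $i\in\{1,\dots,m\}$, with $\beta_i=\frac mi$, every integer $t\ge 1$ and every decomposable $\mathbf v=\mathbf v_1\wedge\dots\wedge\mathbf v_i\in\bigwedge^i\mathbf K_\nu^{m+n}$, $$\int_{\operatorname{SL}_{m+n}(\mathcal O_\nu)}\|g_t\mathbf k\mathbf v\|^{-\beta_i}\,d\lambda(\mathbf k)\le C\,t\,q_\nu^{-mnt}\,\|\mathbf v\|^{-\beta_i},$$ where $0^{-\beta_i}=\infty$ (so that both sides are infinite for $\mathbf v=0$). -/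

import Mathlib

open scoped NNReal ENNReal WithZero

noncomputable section

namespace NonarchWedge

section Field

/- `L` is a field with a discrete valuation written multiplicatively: if `ν` is the additive
valuation, then `Valued.v x = exp (-ν x)` in `ℤᵐ⁰` for `x ≠ 0`, and `Valued.v 0 = 0`. -/
variable (L : Type*) [Field L] [Valued L ℤᵐ⁰]

/-- The cardinality `q_ν` of the residue field `𝒪_ν / π_ν 𝒪_ν`. -/
def residueCard : ℕ := Nat.card (IsLocalRing.ResidueField (Valued.integer L))

variable {L}

/-- The absolute value `|x| = q_ν ^ (-ν x)` for `x ≠ 0`, and `|0| = 0`. -/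
def absVal (x : L) : ℝ≥0 :=
  open scoped Classical in
  if x = 0 then 0 else (residueCard L : ℝ≥0) ^ WithZero.log (Valued.v x : ℤᵐ⁰)

/-- The norm `‖v‖ = max_I |v_I|` on `⋀^i L^d`, where `v = ∑_I v_I e_I` in the standard basis
`e_I = e_{j_1} ∧ ⋯ ∧ e_{j_i}`, `I = {j_1 < ⋯ < j_i}`. -/
def wedgeNorm {d i : ℕ} (v : ⋀[L]^i (Fin d → L)) : ℝ≥0 :=
  Finset.univ.sup fun I : Set.powersetCard (Fin d) i =>
    absVal (((Pi.basisFun L (Fin d)).exteriorPower i).repr v I)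

end Field

section Algebra

variable {L : Type*} [Field L]

/-- `v` is decomposable if `v = v_1 ∧ ⋯ ∧ v_i` for some `v_1, …, v_i ∈ L^d`. -/
def IsDecomposable {d i : ℕ} (v : ⋀[L]^i (Fin d → L)) : Prop :=
  ∃ w : Fin i → (Fin d → L), v = exteriorPower.ιMulti L i w

/-- The linear action of a matrix on `⋀^i L^d`, determined by
`A • (v_1 ∧ ⋯ ∧ v_i) = (A v_1) ∧ ⋯ ∧ (A v_i)`. -/
def wedgeAct {d : ℕ} (i : ℕ) (A : Matrix (Fin d) (Fin d) L) :
    ⋀[L]^i (Fin d → L) →ₗ[L] ⋀[L]^i (Fin d → L) :=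
  exteriorPower.map i A.mulVecLin

/-- The matrix `g_t = diag(π^{-nt}, …, π^{-nt}, π^{mt}, …, π^{mt})`, with `m` entries `π^{-nt}`
followed by `n` entries `π^{mt}`. -/
def flow (m n : ℕ) (ϖ : L) (t : ℤ) : Matrix (Fin (m + n)) (Fin (m + n)) L :=
  Matrix.diagonal (Fin.addCases (fun _ => ϖ ^ (-((n : ℤ) * t))) (fun _ => ϖ ^ ((m : ℤ) * t)))

end Algebra

/-- The group `SL_d(𝒪)` of matrices with entries in the valuation ring and determinant `1`. -/
abbrev SLInt (d : ℕ) (L : Type*) [Field L] [Valued L ℤᵐ⁰] : Type _ :=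
  Matrix.SpecialLinearGroup (Fin d) (Valued.integer L)

/-- An element of `SL_d(𝒪)`, seen as a matrix with entries in `L`. -/
def SLInt.toMatrix {d : ℕ} {L : Type*} [Field L] [Valued L ℤᵐ⁰] (k : SLInt d L) :
    Matrix (Fin d) (Fin d) L :=
  (k : Matrix (Fin d) (Fin d) (Valued.integer L)).map fun x => (x : L)

end NonarchWedge

end

/-! Put d = m + n and write v as a d × i matrix V, so that ‖v‖ is the largest absolute value of a
maximal minor (`wedgeNorm_ιMulti`). For k in SL_d(𝒪), kV = V'B with V' integral, containing an
identity block, and |det B| = ‖v‖. Since g_t = ϖ^{mt} diag(ϖ^{-T}, 1) with T = (m+n)t, for A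
integral with unit determinant the norm of g_t A V' is at least q^{nti} / K(X), where X consists of
the first m rows of AV' and K(X) is the size of the kernel of X on (𝒪/ϖᵀ)ⁱ (`pow_mul_minorNorm_le`).
Raising to the power -m/i produces q^{-mnt} K(X)^{m/i}, so what is needed is that K^{m/i} has
average O(t).

By invariance of the Haar measure the integrand may be averaged over translates indexed by the
invertible A modulo ϖᵀ, lifted and corrected to determinant one. These A have density at least
2^{-d} (`card_le_card_det_ne_zero`), so A may range over all matrices, and then X is uniform
(`expect_mul_right`).

With m = s + i one has m/i ≤ s + 1, and the moment of order s + 1 is bounded by recursion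
(`IsKernelSize.expect_succ_le`, `IsKernelSize.expect_le`). Either X has a unit entry, and a Schur
complement removes a row and a column, or X = ϖX', which has probability q^{-mi} and multiplies K by
qⁱ. The net factor per level is q^{-i(i-1)}: at most 1/2 for i ≥ 2, but 1 for i = 1. Only the
one-column case grows linearly in T, and this is the source of the factor t. -/

noncomputable section

namespace NonarchWedge

/-! ### The ultrametric absolute value. -/

section AbsVal

variable {L : Type*} [Field L] [Valued L ℤᵐ⁰]

@[simp] lemma absVal_zero : absVal (0 : L) = 0 := by simp [absVal]

lemma absVal_of_ne_zero {x : L} (hx : x ≠ 0) :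
    absVal x = (residueCard L : ℝ≥0) ^ WithZero.log (Valued.v x : ℤᵐ⁰) := by simp [absVal, hx]

@[simp] lemma absVal_one : absVal (1 : L) = 1 := by simp [absVal]

lemma absVal_mul (hq : 1 < residueCard L) (x y : L) : absVal (x * y) = absVal x * absVal y := by
  have hq0 : (residueCard L : ℝ≥0) ≠ 0 := by exact_mod_cast (by omega : residueCard L ≠ 0)
  rcases eq_or_ne x 0 with rfl | hx
  · simp
  rcases eq_or_ne y 0 with rfl | hy
  · simp
  rw [absVal_of_ne_zero hx, absVal_of_ne_zero hy, absVal_of_ne_zero (mul_ne_zero hx hy), map_mul,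
    WithZero.log_mul ((Valuation.ne_zero_iff _).2 hx) ((Valuation.ne_zero_iff _).2 hy),
    zpow_add₀ hq0]

lemma absVal_ne_zero (hq : 1 < residueCard L) {x : L} (hx : x ≠ 0) : absVal x ≠ 0 := by
  have hq0 : (residueCard L : ℝ≥0) ≠ 0 := by exact_mod_cast (by omega : residueCard L ≠ 0)
  rw [absVal_of_ne_zero hx]
  exact zpow_ne_zero _ hq0

lemma absVal_le_absVal_iff (hq : 1 < residueCard L) {x y : L} :
    absVal x ≤ absVal y ↔ (Valued.v x : ℤᵐ⁰) ≤ Valued.v y := by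
  have hq1 : (1 : ℝ≥0) < residueCard L := by exact_mod_cast hq
  rcases eq_or_ne x 0 with rfl | hx
  · simp
  rcases eq_or_ne y 0 with rfl | hy
  · simp [absVal_ne_zero hq hx, hx]
  rw [absVal_of_ne_zero hx, absVal_of_ne_zero hy, zpow_le_zpow_iff_right₀ hq1,
    WithZero.log_le_log ((Valuation.ne_zero_iff _).2 hx) ((Valuation.ne_zero_iff _).2 hy)]

lemma absVal_le_one_iff (hq : 1 < residueCard L) {x : L} :
    absVal x ≤ 1 ↔ (Valued.v x : ℤᵐ⁰) ≤ 1 := by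
  have h := absVal_le_absVal_iff hq (x := x) (y := 1)
  simpa using h

lemma absVal_coe_le_one (hq : 1 < residueCard L) (x : Valued.integer L) : absVal (x : L) ≤ 1 :=
  (absVal_le_one_iff hq).2 x.2

lemma absVal_coe_eq_one (hq : 1 < residueCard L) {x : Valued.integer L} (hx : IsUnit x) :
    absVal (x : L) = 1 := by
  obtain ⟨u, rfl⟩ := hx
  have h1 := absVal_coe_le_one hq (u : Valued.integer L)
  have h2 := absVal_coe_le_one hq ((u⁻¹ : (Valued.integer L)ˣ) : Valued.integer L)
  have h3 : absVal ((u : Valued.integer L) : L) *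
      absVal (((u⁻¹ : (Valued.integer L)ˣ) : Valued.integer L) : L) = 1 := by
    rw [← absVal_mul hq, ← Subring.coe_mul, Units.mul_inv]; simp
  refine le_antisymm h1 ?_
  calc 1 = _ := h3.symm
    _ ≤ absVal ((u : Valued.integer L) : L) * 1 := by gcongr
    _ = _ := mul_one _

lemma absVal_add_le (hq : 1 < residueCard L) (x y : L) :
    absVal (x + y) ≤ max (absVal x) (absVal y) := by
  rcases le_total (Valued.v x : ℤᵐ⁰) (Valued.v y) with h | h
  · rw [max_eq_right ((absVal_le_absVal_iff hq).2 h), absVal_le_absVal_iff hq]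
    exact (Valuation.map_add _ _ _).trans (max_le h le_rfl)
  · rw [max_eq_left ((absVal_le_absVal_iff hq).2 h), absVal_le_absVal_iff hq]
    exact (Valuation.map_add _ _ _).trans (max_le le_rfl h)

lemma absVal_sum_le (hq : 1 < residueCard L) {ι : Type*} (s : Finset ι) (f : ι → L) (B : ℝ≥0)
    (h : ∀ i ∈ s, absVal (f i) ≤ B) : absVal (∑ i ∈ s, f i) ≤ B := by
  classical
  induction s using Finset.induction_on with
  | empty => simp
  | insert a s ha ih =>
    rw [Finset.sum_insert ha]
    refine (absVal_add_le hq _ _).trans (max_le (h _ (by simp)) (ih fun i hi => h i ?_))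
    simp [hi]

lemma absVal_pow (hq : 1 < residueCard L) (x : L) (k : ℕ) : absVal (x ^ k) = absVal x ^ k := by
  induction k with
  | zero => simp
  | succ k ih => rw [pow_succ, absVal_mul hq, ih, pow_succ]

lemma uniformizer_ne_zero {ϖ : L} (hϖ : (Valued.v ϖ : ℤᵐ⁰) = WithZero.exp (-1)) : ϖ ≠ 0 := by
  rintro rfl
  rw [map_zero] at hϖ
  exact WithZero.exp_ne_zero hϖ.symm

lemma absVal_uniformizer {ϖ : L} (hϖ : (Valued.v ϖ : ℤᵐ⁰) = WithZero.exp (-1)) :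
    absVal ϖ = (residueCard L : ℝ≥0)⁻¹ := by
  rw [absVal_of_ne_zero (uniformizer_ne_zero hϖ), hϖ, WithZero.log_exp, zpow_neg_one]

lemma absVal_inv (hq : 1 < residueCard L) (x : L) : absVal x⁻¹ = (absVal x)⁻¹ := by
  rcases eq_or_ne x 0 with rfl | hx
  · simp
  · apply eq_inv_of_mul_eq_one_left
    rw [← absVal_mul hq, inv_mul_cancel₀ hx, absVal_one]

lemma absVal_zpow (hq : 1 < residueCard L) (x : L) (k : ℤ) : absVal (x ^ k) = absVal x ^ k := by
  cases k with
  | ofNat k => simpa using absVal_pow hq x k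
  | negSucc k => simp [absVal_inv hq, absVal_pow hq]

end AbsVal

/-! ### Maximal minors under integral row operations and column changes. -/

section MinorNorm

/-- Expansion of the minors of a product along the rows of the first factor. -/
lemma det_mul_eq_sum {R ρ : Type*} [CommRing R] [Fintype ρ] {i : ℕ}
    (P : Matrix (Fin i) ρ R) (M : Matrix ρ (Fin i) R) :
    (P * M).det = ∑ f : Fin i → ρ, (∏ j, P j (f j)) * (M.submatrix f id).det := by
  classical
  have h1 : (P * M) = fun j => ∑ r, P j r • M r := by
    ext j y
    simp [Matrix.mul_apply, Finset.sum_apply]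
  have h2 := (Matrix.detRowAlternating (n := Fin i) (R := R)).toMultilinearMap.map_sum
    (fun j r => P j r • M r)
  rw [h1]
  refine h2.trans (Finset.sum_congr rfl fun f _ => ?_)
  exact (Matrix.detRowAlternating (n := Fin i) (R := R)).toMultilinearMap.map_smul_univ
    (fun j => P j (f j)) (fun j => M (f j))

variable {L : Type*} [Field L] [Valued L ℤᵐ⁰]
variable {ρ σ : Type*} [Fintype ρ] [Fintype σ] {i : ℕ}

/-- The maximal absolute value of a maximal minor of a matrix with `i` columns. -/
def minorNorm (M : Matrix ρ (Fin i) L) : ℝ≥0 := by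
  classical exact Finset.univ.sup fun f : Fin i → ρ => absVal (M.submatrix f id).det

lemma absVal_det_le_minorNorm (M : Matrix ρ (Fin i) L) (f : Fin i → ρ) :
    absVal (M.submatrix f id).det ≤ minorNorm M := by
  classical
  exact Finset.le_sup (f := fun f : Fin i → ρ => absVal (M.submatrix f id).det) (Finset.mem_univ f)

lemma minorNorm_le {M : Matrix ρ (Fin i) L} {B : ℝ≥0}
    (h : ∀ f : Fin i → ρ, absVal (M.submatrix f id).det ≤ B) : minorNorm M ≤ B := by
  classical
  exact Finset.sup_le fun f _ => h f

/-- A minor attaining the maximum, provided that there is one. -/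
lemma exists_minorNorm_eq {M : Matrix ρ (Fin i) L} (h : minorNorm M ≠ 0) :
    ∃ f : Fin i → ρ, absVal (M.submatrix f id).det = minorNorm M := by
  classical
  by_cases hne : Nonempty (Fin i → ρ)
  · obtain ⟨f, -, hf⟩ := Finset.exists_mem_eq_sup Finset.univ Finset.univ_nonempty
      fun f : Fin i → ρ => absVal (M.submatrix f id).det
    exact ⟨f, hf.symm⟩
  · refine absurd (le_antisymm (minorNorm_le fun f => (hne ⟨f⟩).elim) zero_le) h

lemma absVal_prod_le_one (hq : 1 < residueCard L) {ι : Type*} (s : Finset ι) (f : ι → L)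
    (h : ∀ j ∈ s, absVal (f j) ≤ 1) : absVal (∏ j ∈ s, f j) ≤ 1 := by
  classical
  induction s using Finset.induction_on with
  | empty => simp
  | insert a s ha ih =>
    rw [Finset.prod_insert ha, absVal_mul hq]
    exact mul_le_one' (h _ (by simp)) (ih fun i hi => h i (by simp [hi]))

/-- Each minor of `P * M` is an integral combination of minors of `M`, so the ultrametric inequality
applies. Used for `P` and its inverse, this gives invariance under integral matrices with integral
inverse. -/
lemma minorNorm_mul_le (hq : 1 < residueCard L) (P : Matrix σ ρ L) (M : Matrix ρ (Fin i) L)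
    (hP : ∀ x y, absVal (P x y) ≤ 1) : minorNorm (P * M) ≤ minorNorm M := by
  refine minorNorm_le fun g => ?_
  have : (P * M).submatrix g id = (P.submatrix g id) * M := by
    ext; simp [Matrix.mul_apply]
  rw [this, det_mul_eq_sum]
  refine absVal_sum_le hq _ _ _ fun f _ => ?_
  rw [absVal_mul hq]
  calc _ ≤ 1 * minorNorm M := by
        gcongr
        · exact absVal_prod_le_one hq _ _ fun j _ => hP _ _
        · exact absVal_det_le_minorNorm M f
    _ = _ := one_mul _

lemma minorNorm_mul_right (hq : 1 < residueCard L) (M : Matrix ρ (Fin i) L)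
    (B : Matrix (Fin i) (Fin i) L) : minorNorm (M * B) = minorNorm M * absVal B.det := by
  classical
  have h : ∀ f : Fin i → ρ, absVal ((M * B).submatrix f id).det =
      absVal (M.submatrix f id).det * absVal B.det := fun f => by
    have : (M * B).submatrix f id = (M.submatrix f id) * B := by
      ext; simp [Matrix.mul_apply]
    rw [this, Matrix.det_mul, absVal_mul hq]
  simp only [minorNorm, h]
  exact (NNReal.finset_sup_mul _ _ _).symm

lemma minorNorm_smul (hq : 1 < residueCard L) (c : L) (M : Matrix ρ (Fin i) L) :
    minorNorm (c • M) = absVal c ^ i * minorNorm M := by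
  have : c • M = M * (c • (1 : Matrix (Fin i) (Fin i) L)) := by simp
  rw [this, minorNorm_mul_right hq, mul_comm]
  simp [absVal_pow hq]

/-- Replacing row `j` of the identity block by row `x` produces a minor equal to the entry `M x j`.
-/
lemma absVal_apply_le_of_submatrix_eq_one {M : Matrix ρ (Fin i) L}
    {f : Fin i → ρ} (hf : M.submatrix f id = 1) (x : ρ) (j : Fin i) :
    absVal (M x j) ≤ minorNorm M := by
  classical
  have h : (M.submatrix (Function.update f j x) id).det = M x j := by
    have h1 : M.submatrix (Function.update f j x) id =
        (1 : Matrix (Fin i) (Fin i) L).updateRow j (M x) := by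
      rw [← hf]
      ext a b
      by_cases ha : a = j
      · subst ha; simp
      · simp [ha]
    rw [h1, ← Matrix.det_transpose, ← Matrix.updateCol_transpose, Matrix.transpose_one,
      ← Matrix.cramer_apply, Matrix.cramer_one]
    rfl
  rw [← h]
  exact absVal_det_le_minorNorm M _

/-- A matrix of full rank is the product of an integral matrix containing an identity block
with an invertible matrix. -/
lemma exists_eq_mul_of_minorNorm_ne_zero (hq : 1 < residueCard L) {M : Matrix ρ (Fin i) L}
    (h : minorNorm M ≠ 0) :
    ∃ (V : Matrix ρ (Fin i) L) (B : Matrix (Fin i) (Fin i) L) (f : Fin i → ρ),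
      M = V * B ∧ absVal B.det = minorNorm M ∧ V.submatrix f id = 1 ∧
        ∀ x j, absVal (V x j) ≤ 1 := by
  obtain ⟨f, hf⟩ := exists_minorNorm_eq h
  set B := M.submatrix f id with hB
  have hdet : B.det ≠ 0 := by
    intro h0; rw [h0, absVal_zero] at hf; exact h hf.symm
  have hu : IsUnit B.det := isUnit_iff_ne_zero.2 hdet
  have hV1 : (M * B⁻¹).submatrix f id = 1 := by
    have : (M * B⁻¹).submatrix f id = B * B⁻¹ := by ext; simp [hB, Matrix.mul_apply]
    rw [this, Matrix.mul_nonsing_inv _ hu]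
  have hVB : M = M * B⁻¹ * B := by rw [Matrix.mul_assoc, Matrix.nonsing_inv_mul _ hu, Matrix.mul_one]
  refine ⟨M * B⁻¹, B, f, hVB, hf, hV1, fun x j => ?_⟩
  refine (absVal_apply_le_of_submatrix_eq_one hV1 x j).trans ?_
  -- Because `B` is a largest minor, `M * B⁻¹` has minor norm 1, which bounds all its entries.
  have h2 := minorNorm_mul_right hq (M * B⁻¹) B
  rw [← hVB, hf] at h2
  exact (mul_right_cancel₀ h (by rw [one_mul]; exact h2.symm)).le

end MinorNorm

/-! ### The norm of a decomposable vector as a minor norm. -/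

section Wedge

variable {L : Type*} [Field L] [Valued L ℤᵐ⁰] {d i : ℕ}

/-- The wedge norm sees only increasing row selections, `minorNorm` all of them. Any selection `f`
gives a linear functional `φ` with integral values on the standard basis, so its minor is bounded by
the coordinates; no sorting of `f` is needed. -/
lemma wedgeNorm_ιMulti (hq : 1 < residueCard L) (w : Fin i → Fin d → L) :
    wedgeNorm (exteriorPower.ιMulti L i w) =
      minorNorm (Matrix.of fun (r : Fin d) (j : Fin i) => w j r) := by
  classical
  have key : ∀ I : Set.powersetCard (Fin d) i,
      ((Pi.basisFun L (Fin d)).exteriorPower i).repr (exteriorPower.ιMulti L i w) I =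
      ((Matrix.of fun (r : Fin d) (j : Fin i) => w j r).submatrix
        (Set.powersetCard.ofFinEmbEquiv.symm I) id).det := by
    intro I
    rw [exteriorPower.basis_repr_apply, exteriorPower.ιMultiDual_apply_ιMulti,
      ← Matrix.det_transpose]
    congr 1
  apply le_antisymm
  · refine Finset.sup_le fun I _ => ?_
    rw [key]
    exact absVal_det_le_minorNorm _ _
  · refine minorNorm_le fun f => ?_
    let φ : ⋀[L]^i (Fin d → L) →ₗ[L] L := exteriorPower.alternatingMapLinearEquiv
      (Matrix.detRowAlternating.compLinearMap (LinearMap.funLeft L L f))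
    have hφ : ∀ u : Fin i → Fin d → L, φ (exteriorPower.ιMulti L i u) =
        (Matrix.of fun j l => u j (f l)).det := fun u => by
      simp only [φ, exteriorPower.alternatingMapLinearEquiv_apply_ιMulti]
      rfl
    have hv := ((Pi.basisFun L (Fin d)).exteriorPower i).sum_repr (exteriorPower.ιMulti L i w)
    have h1 : ((Matrix.of fun (r : Fin d) (j : Fin i) => w j r).submatrix f id).det =
        φ (exteriorPower.ιMulti L i w) := by
      rw [hφ, ← Matrix.det_transpose]
      rfl
    rw [h1]
    conv_lhs => rw [← hv, map_sum]
    refine absVal_sum_le hq _ _ _ fun I _ => ?_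
    rw [map_smul, smul_eq_mul, absVal_mul hq]
    have h2 : absVal (φ (((Pi.basisFun L (Fin d)).exteriorPower i) I)) ≤ 1 := by
      rw [exteriorPower.basis_apply]
      change absVal (φ (exteriorPower.ιMulti L i _)) ≤ 1
      rw [hφ]
      set N : Matrix (Fin i) (Fin i) (Valued.integer L) := Matrix.of fun j l =>
        (Pi.basisFun (Valued.integer L) (Fin d) (Set.powersetCard.ofFinEmbEquiv.symm I j)) (f l)
      have : (Matrix.of fun j l =>
          ((Pi.basisFun L (Fin d)) ∘ (Set.powersetCard.ofFinEmbEquiv.symm I)) j (f l)) =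
          (Valued.integer L).subtype.mapMatrix N := by
        ext j l
        simp only [N, Matrix.of_apply, Function.comp, Pi.basisFun_apply, RingHom.mapMatrix_apply,
          Matrix.map_apply, Pi.single_apply]
        split_ifs <;> simp
      rw [this, ← RingHom.map_det]
      exact absVal_coe_le_one hq _
    calc _ ≤ wedgeNorm (exteriorPower.ιMulti L i w) * 1 := by
          gcongr
          exact Finset.le_sup (f := fun I : Set.powersetCard (Fin d) i =>
            absVal (((Pi.basisFun L (Fin d)).exteriorPower i).repr _ I)) (Finset.mem_univ I)
      _ = _ := mul_one _

lemma wedgeNorm_wedgeAct_ιMulti (hq : 1 < residueCard L) (A : Matrix (Fin d) (Fin d) L)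
    (w : Fin i → Fin d → L) :
    wedgeNorm (wedgeAct i A (exteriorPower.ιMulti L i w)) =
      minorNorm (A * Matrix.of fun (r : Fin d) (j : Fin i) => w j r) := by
  rw [wedgeAct, exteriorPower.map_apply_ιMulti, wedgeNorm_ιMulti hq]
  rfl

end Wedge

/-! ### Kernel sizes modulo ϖᵀ and their behaviour under reduction steps. -/

/-- The Schur complement of the top left entry. -/
def schurCompl {R : Type*} [CommRing R] {m i : ℕ} (U : Matrix (Fin (m + 1)) (Fin (i + 1)) R) :
    Matrix (Fin m) (Fin i) R :=
  Matrix.of fun x y => U x.succ y.succ - U x.succ 0 * Ring.inverse (U 0 0) * U 0 y.succ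

section AugNorm

variable {L : Type*} [Field L] [Valued L ℤᵐ⁰] {m i : ℕ} {ϖ : L}

/-- The maximal absolute value of the maximal minors of the matrix with blocks `ϖ⁻ᵀ X` and `1`. -/
def augNorm (ϖ : L) (T : ℕ) (X : Matrix (Fin m) (Fin i) L) : ℝ≥0 :=
  minorNorm (Matrix.fromRows (ϖ ^ (-(T : ℤ)) • X) (1 : Matrix (Fin i) (Fin i) L))

lemma one_le_augNorm (T : ℕ) (X : Matrix (Fin m) (Fin i) L) : 1 ≤ augNorm ϖ T X := by
  have h := absVal_det_le_minorNorm
    (Matrix.fromRows (ϖ ^ (-(T : ℤ)) • X) (1 : Matrix (Fin i) (Fin i) L)) Sum.inr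
  have h1 : (Matrix.fromRows (ϖ ^ (-(T : ℤ)) • X) (1 : Matrix (Fin i) (Fin i) L)).submatrix
    Sum.inr id = 1 := by ext; simp
  rwa [h1, Matrix.det_one, absVal_one] at h

lemma minorNorm_le_one (hq : 1 < residueCard L) {ρ : Type*} [Fintype ρ] {M : Matrix ρ (Fin i) L}
    (hM : ∀ x y, absVal (M x y) ≤ 1) : minorNorm M ≤ 1 := by
  have h := minorNorm_mul_le hq M (1 : Matrix (Fin i) (Fin i) L) hM
  rw [Matrix.mul_one] at h
  refine h.trans (minorNorm_le fun f => ?_)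
  have : (1 : Matrix (Fin i) (Fin i) L).submatrix f id =
      (Valued.integer L).subtype.mapMatrix ((1 : Matrix (Fin i) (Fin i) _).submatrix f id) := by
    ext a b
    simp only [Matrix.submatrix_apply, RingHom.mapMatrix_apply, Matrix.map_apply, Matrix.one_apply]
    split_ifs <;> simp
  rw [this, ← RingHom.map_det]
  exact absVal_coe_le_one hq _

lemma absVal_one_apply_le {ρ : Type*} [DecidableEq ρ] (x y : ρ) :
    absVal ((1 : Matrix ρ ρ L) x y) ≤ 1 := by
  rw [Matrix.one_apply]; split_ifs <;> simp

lemma absVal_uniformizer_pow (hq : 1 < residueCard L)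
    (hϖ : (Valued.v ϖ : ℤᵐ⁰) = WithZero.exp (-1)) (k : ℕ) :
    absVal (ϖ ^ k) = ((residueCard L : ℝ≥0) ^ k)⁻¹ := by
  rw [absVal_pow hq, absVal_uniformizer hϖ, inv_pow]

lemma absVal_uniformizer_zpow (hq : 1 < residueCard L)
    (hϖ : (Valued.v ϖ : ℤᵐ⁰) = WithZero.exp (-1)) (k : ℤ) :
    absVal (ϖ ^ k) = (residueCard L : ℝ≥0) ^ (-k) := by
  rw [absVal_zpow hq, absVal_uniformizer hϖ, inv_zpow, zpow_neg]

lemma absVal_uniformizer_pow_le_one (hq : 1 < residueCard L)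
    (hϖ : (Valued.v ϖ : ℤᵐ⁰) = WithZero.exp (-1)) (k : ℕ) : absVal (ϖ ^ k) ≤ 1 := by
  rw [absVal_uniformizer_pow hq hϖ]
  refine inv_le_one_of_one_le₀ (one_le_pow₀ ?_)
  exact_mod_cast hq.le

lemma augNorm_le (hq : 1 < residueCard L) (hϖ : (Valued.v ϖ : ℤᵐ⁰) = WithZero.exp (-1)) (T : ℕ)
    {X : Matrix (Fin m) (Fin i) L} (hX : ∀ x y, absVal (X x y) ≤ 1) :
    augNorm ϖ T X ≤ (residueCard L : ℝ≥0) ^ (T * i) := by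
  have h0 := uniformizer_ne_zero hϖ
  have hW : (Matrix.fromRows (ϖ ^ (-(T : ℤ)) • X) (1 : Matrix (Fin i) (Fin i) L)) =
      ϖ ^ (-(T : ℤ)) • Matrix.fromRows X (ϖ ^ T • (1 : Matrix (Fin i) (Fin i) L)) := by
    ext (x | x) y
    · simp
    · simp [h0]
  rw [augNorm, hW, minorNorm_smul hq, absVal_uniformizer_zpow hq hϖ, neg_neg, zpow_natCast,
    ← pow_mul]
  refine mul_le_of_le_one_right' (minorNorm_le_one hq ?_)
  rintro (x | x) y
  · exact hX x y
  · rw [Matrix.fromRows_apply_inr, Matrix.smul_apply, smul_eq_mul, absVal_mul hq]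
    exact mul_le_one' (absVal_uniformizer_pow_le_one hq hϖ T) (absVal_one_apply_le x y)

/-- Adding ϖᵀZ amounts to multiplying the stacked matrix by an integral unipotent block matrix.
Hence `augNorm` depends only on X modulo ϖᵀ. -/
lemma augNorm_add_le (hq : 1 < residueCard L) (h0 : ϖ ≠ 0) (T : ℕ)
    (X Z : Matrix (Fin m) (Fin i) L) (hZ : ∀ x y, absVal (Z x y) ≤ 1) :
    augNorm ϖ T (X + ϖ ^ T • Z) ≤ augNorm ϖ T X := by
  set P : Matrix (Fin m ⊕ Fin i) (Fin m ⊕ Fin i) L := Matrix.fromBlocks 1 Z 0 1 with hP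
  have : Matrix.fromRows (ϖ ^ (-(T : ℤ)) • (X + ϖ ^ T • Z)) (1 : Matrix (Fin i) (Fin i) L) =
      P * Matrix.fromRows (ϖ ^ (-(T : ℤ)) • X) (1 : Matrix (Fin i) (Fin i) L) := by
    rw [hP, Matrix.fromBlocks_mul_fromRows]
    congr 1
    · rw [smul_add, smul_smul]; simp [h0]
    · simp
  rw [augNorm, this]
  refine minorNorm_mul_le hq _ _ ?_
  rintro (x | x) (y | y)
  · exact absVal_one_apply_le x y
  · exact hZ x y
  · simp [hP]
  · exact absVal_one_apply_le x y

lemma augNorm_uniformizer_smul (h0 : ϖ ≠ 0) (T : ℕ) (X : Matrix (Fin m) (Fin i) L) :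
    augNorm ϖ (T + 1) (ϖ • X) = augNorm ϖ T X := by
  rw [augNorm, augNorm, smul_smul]
  congr 3
  rw [← zpow_add_one₀ h0]
  congr 1
  push_cast; ring

lemma augNorm_submatrix_le (T : ℕ) (X : Matrix (Fin m) (Fin i) L)
    (e₁ : Fin m ≃ Fin m) (e₂ : Fin i ≃ Fin i) :
    augNorm ϖ T (X.submatrix e₁ e₂) ≤ augNorm ϖ T X := by
  refine minorNorm_le fun f => ?_
  set W := Matrix.fromRows (ϖ ^ (-(T : ℤ)) • X) (1 : Matrix (Fin i) (Fin i) L) with hW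
  have : (Matrix.fromRows (ϖ ^ (-(T : ℤ)) • X.submatrix e₁ e₂)
      (1 : Matrix (Fin i) (Fin i) L)).submatrix f id =
      (W.submatrix (Sum.map e₁ e₂ ∘ f ∘ e₂.symm) id).submatrix e₂ e₂ := by
    ext a b
    rcases h : f a with x | x
    · simp [hW, h]
    · simp [hW, h, Matrix.one_apply]
  rw [this, Matrix.det_submatrix_equiv_self]
  exact absVal_det_le_minorNorm _ _

lemma augNorm_submatrix (T : ℕ) (X : Matrix (Fin m) (Fin i) L)
    (e₁ : Fin m ≃ Fin m) (e₂ : Fin i ≃ Fin i) :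
    augNorm ϖ T (X.submatrix e₁ e₂) = augNorm ϖ T X := by
  refine le_antisymm (augNorm_submatrix_le T X e₁ e₂) ?_
  have h := augNorm_submatrix_le (ϖ := ϖ) T (X.submatrix e₁ e₂) e₁.symm e₂.symm
  simpa using h

/-- Every minor of the stacked matrix of the Schur complement is bordered by row 0 of ϖ⁻ᵀU. Column
operations with the unit pivot then split off the factor ϖ⁻ᵀ U₀₀, of absolute value qᵀ. -/
lemma mul_augNorm_schurCompl_le (hq : 1 < residueCard L)
    (hϖ : (Valued.v ϖ : ℤᵐ⁰) = WithZero.exp (-1)) (T : ℕ)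
    (U : Matrix (Fin (m + 1)) (Fin (i + 1)) L) (hU : absVal (U 0 0) = 1) :
    (residueCard L : ℝ≥0) ^ T * augNorm ϖ T (schurCompl U) ≤ augNorm ϖ T U := by
  have hU0 : U 0 0 ≠ 0 := by
    intro h; rw [h, absVal_zero] at hU; exact zero_ne_one hU
  have hq0 : (residueCard L : ℝ≥0) ^ T ≠ 0 := by
    have : (residueCard L : ℝ≥0) ≠ 0 := by exact_mod_cast (by omega : residueCard L ≠ 0)
    positivity
  rw [mul_comm, ← le_div_iff₀ (pos_iff_ne_zero.2 hq0)]
  refine minorNorm_le fun f => ?_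
  rw [le_div_iff₀ (pos_iff_ne_zero.2 hq0)]
  set g : Fin (i + 1) → Fin (m + 1) ⊕ Fin (i + 1) :=
    Fin.cons (Sum.inl 0) (Sum.map Fin.succ Fin.succ ∘ f) with hg
  set A := (Matrix.fromRows (ϖ ^ (-(T : ℤ)) • U)
    (1 : Matrix (Fin (i + 1)) (Fin (i + 1)) L)).submatrix g id with hA
  -- Multiples of column 0 that clear the rest of the pivot row; rows coming from the identity block
  -- have a zero in column 0 and keep their other entries.
  set c : Fin (i + 1) → L := Fin.cons 0 fun y => (U 0 0)⁻¹ * U 0 y.succ with hc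
  set B : Matrix (Fin (i + 1)) (Fin (i + 1)) L := Matrix.of fun x y => A x y - c y * A x 0 with hB
  have hAB : A.det = B.det := by
    rw [← Matrix.det_transpose A, ← Matrix.det_transpose B]
    refine Matrix.det_eq_of_forall_row_eq_smul_add_const c 0 (by simp [hc]) fun y x => ?_
    simp [hB, hc]
  have hB0 : ∀ y : Fin i, B 0 y.succ = 0 := fun y => by
    simp [hB, hA, hg, hc]
    field_simp
    ring
  have hB00 : B 0 0 = ϖ ^ (-(T : ℤ)) * U 0 0 := by simp [hB, hA, hg, hc]
  have hBsub : B.submatrix Fin.succ Fin.succ =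
      (Matrix.fromRows (ϖ ^ (-(T : ℤ)) • schurCompl U)
        (1 : Matrix (Fin i) (Fin i) L)).submatrix f id := by
    ext a b
    rcases h : f a with x | x
    · simp [hB, hA, hg, hc, h, schurCompl]
      ring
    · simp [hB, hA, hg, hc, h, Matrix.one_apply]
  have hdet : B.det = ϖ ^ (-(T : ℤ)) * U 0 0 * ((Matrix.fromRows (ϖ ^ (-(T : ℤ)) • schurCompl U)
        (1 : Matrix (Fin i) (Fin i) L)).submatrix f id).det := by
    rw [← hBsub, Matrix.det_succ_row_zero, Fin.sum_univ_succ]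
    simp only [hB0, hB00]
    simp [Fin.succAbove_zero]
  have h1 := absVal_det_le_minorNorm (Matrix.fromRows (ϖ ^ (-(T : ℤ)) • U)
    (1 : Matrix (Fin (i + 1)) (Fin (i + 1)) L)) g
  rw [← hA, hAB, hdet, absVal_mul hq, absVal_mul hq, hU, absVal_uniformizer_zpow hq hϖ, neg_neg,
    zpow_natCast, mul_one, mul_comm] at h1
  exact h1

/-- The cardinality of the kernel of `X` acting on `(𝒪 / ϖᵀ)ⁱ`, for integral `X`. -/
def kernelSize (ϖ : L) (T : ℕ) (X : Matrix (Fin m) (Fin i) L) : ℝ≥0 :=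
  (residueCard L : ℝ≥0) ^ (T * i) / augNorm ϖ T X

lemma one_le_kernelSize (hq : 1 < residueCard L) (hϖ : (Valued.v ϖ : ℤᵐ⁰) = WithZero.exp (-1))
    (T : ℕ) {X : Matrix (Fin m) (Fin i) L} (hX : ∀ x y, absVal (X x y) ≤ 1) :
    1 ≤ kernelSize ϖ T X := by
  rw [kernelSize, one_le_div₀ (zero_lt_one.trans_le (one_le_augNorm T X))]
  exact augNorm_le hq hϖ T hX

lemma kernelSize_le (T : ℕ) (X : Matrix (Fin m) (Fin i) L) :
    kernelSize ϖ T X ≤ (residueCard L : ℝ≥0) ^ (T * i) :=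
  div_le_self (by positivity) (one_le_augNorm T X)

lemma kernelSize_add (hq : 1 < residueCard L) (h0 : ϖ ≠ 0) (T : ℕ)
    (X Z : Matrix (Fin m) (Fin i) L) (hZ : ∀ x y, absVal (Z x y) ≤ 1) :
    kernelSize ϖ T (X + ϖ ^ T • Z) = kernelSize ϖ T X := by
  rw [kernelSize, kernelSize]
  congr 1
  refine le_antisymm (augNorm_add_le hq h0 T X Z hZ) ?_
  have h := augNorm_add_le hq h0 T (X + ϖ ^ T • Z) (-Z) fun x y => by
    rw [Matrix.neg_apply, ← neg_one_mul, absVal_mul hq]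
    have h1 : absVal (-1 : L) ≤ 1 := by rw [absVal_le_one_iff hq]; simp
    exact mul_le_one' h1 (hZ x y)
  simpa using h

lemma kernelSize_uniformizer_smul (h0 : ϖ ≠ 0) (T : ℕ) (X : Matrix (Fin m) (Fin i) L) :
    kernelSize ϖ (T + 1) (ϖ • X) = (residueCard L : ℝ≥0) ^ i * kernelSize ϖ T X := by
  rw [kernelSize, kernelSize, augNorm_uniformizer_smul h0]
  ring

lemma kernelSize_submatrix (T : ℕ) (X : Matrix (Fin m) (Fin i) L)
    (e₁ : Fin m ≃ Fin m) (e₂ : Fin i ≃ Fin i) :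
    kernelSize ϖ T (X.submatrix e₁ e₂) = kernelSize ϖ T X := by
  rw [kernelSize, kernelSize, augNorm_submatrix]

lemma kernelSize_le_schurCompl (hq : 1 < residueCard L)
    (hϖ : (Valued.v ϖ : ℤᵐ⁰) = WithZero.exp (-1)) (T : ℕ)
    (U : Matrix (Fin (m + 1)) (Fin (i + 1)) L) (hU : absVal (U 0 0) = 1) :
    kernelSize ϖ T U ≤ kernelSize ϖ T (schurCompl U) := by
  have hq0 : (residueCard L : ℝ≥0) ≠ 0 := by exact_mod_cast (by omega : residueCard L ≠ 0)
  have h1 := zero_lt_one.trans_le (one_le_augNorm (ϖ := ϖ) T (schurCompl U))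
  rw [kernelSize, kernelSize]
  calc _ ≤ (residueCard L : ℝ≥0) ^ (T * (i + 1)) /
        ((residueCard L : ℝ≥0) ^ T * augNorm ϖ T (schurCompl U)) := by
        gcongr
        exact mul_augNorm_schurCompl_le hq hϖ T U hU
    _ = _ := by
        rw [mul_add, mul_one, pow_add, mul_comm ((residueCard L : ℝ≥0) ^ (T * i)),
          mul_div_mul_left _ _ (pow_ne_zero _ hq0)]

end AugNorm

/-! ### Comparison of the flow with the augmented minors. -/

section Flow

variable {L : Type*} [Field L] [Valued L ℤᵐ⁰] {m n i : ℕ} {ϖ : L}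

/-- With flow = ϖ^{mt} S and S = diag(ϖ⁻ᵀ, 1), the stacked matrix of the top rows of M is P S M with
P integral: the top rows are read off from SM, and the identity block is E S⁻¹ (S M), where S⁻¹ is
integral. The scalar ϖ^{mt} accounts for q^{mti}. -/
lemma augNorm_le_minorNorm_flow (hq : 1 < residueCard L)
    (hϖ : (Valued.v ϖ : ℤᵐ⁰) = WithZero.exp (-1)) (t : ℕ)
    (M : Matrix (Fin (m + n)) (Fin i) L) (E : Matrix (Fin i) (Fin (m + n)) L) (hEM : E * M = 1)
    (hE : ∀ x y, absVal (E x y) ≤ 1) :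
    augNorm ϖ ((m + n) * t) (M.submatrix (Fin.castAdd n) id) ≤
      (residueCard L : ℝ≥0) ^ (m * t * i) * minorNorm (flow m n ϖ t * M) := by
  have h0 := uniformizer_ne_zero hϖ
  set T := (m + n) * t with hT
  set S : Matrix (Fin (m + n)) (Fin (m + n)) L :=
    Matrix.diagonal (Fin.addCases (fun _ => ϖ ^ (-(T : ℤ))) (fun _ => 1)) with hS
  set S' : Matrix (Fin (m + n)) (Fin (m + n)) L :=
    Matrix.diagonal (Fin.addCases (fun _ => ϖ ^ T) (fun _ => 1)) with hS'
  have hflow : flow m n ϖ t = ϖ ^ (m * t) • S := by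
    rw [flow, hS, ← Matrix.diagonal_smul]
    congr 1
    ext x
    refine Fin.addCases (fun a => ?_) (fun a => ?_) x
    · simp only [Fin.addCases_left, Pi.smul_apply, smul_eq_mul, hT]
      rw [← zpow_natCast, ← zpow_add₀ h0]
      congr 1
      push_cast; ring
    · simp only [Fin.addCases_right, Pi.smul_apply, smul_eq_mul, mul_one]
      rw [← zpow_natCast]
      push_cast; rfl
  have hSS : S' * S = 1 := by
    rw [hS, hS', Matrix.diagonal_mul_diagonal, ← Matrix.diagonal_one]
    congr 1
    ext x
    refine Fin.addCases (fun a => ?_) (fun a => ?_) x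
    · simp [h0]
    · simp
  set P : Matrix (Fin m ⊕ Fin i) (Fin (m + n)) L :=
    Matrix.fromRows ((1 : Matrix (Fin (m + n)) (Fin (m + n)) L).submatrix (Fin.castAdd n) id)
      (E * S') with hP
  have hW : Matrix.fromRows (ϖ ^ (-(T : ℤ)) • M.submatrix (Fin.castAdd n) id)
      (1 : Matrix (Fin i) (Fin i) L) = P * (S * M) := by
    rw [hP, Matrix.fromRows_mul]
    congr 1
    · ext x y
      have : ((1 : Matrix (Fin (m + n)) (Fin (m + n)) L).submatrix (Fin.castAdd n) id * (S * M)) x y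
          = ((1 : Matrix (Fin (m + n)) (Fin (m + n)) L) * (S * M)) (Fin.castAdd n x) y := rfl
      rw [this, Matrix.one_mul, hS, Matrix.diagonal_mul]
      simp
    · rw [Matrix.mul_assoc, ← Matrix.mul_assoc S', hSS, Matrix.one_mul, hEM]
  have hPint : ∀ x y, absVal (P x y) ≤ 1 := by
    rintro (x | x) y
    · exact absVal_one_apply_le _ _
    · rw [hP, Matrix.fromRows_apply_inr, hS', Matrix.mul_diagonal, absVal_mul hq]
      refine mul_le_one' (hE x y) ?_
      refine Fin.addCases (fun a => ?_) (fun a => ?_) y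
      · simpa using absVal_uniformizer_pow_le_one hq hϖ T
      · simp
  have hq0 : (residueCard L : ℝ≥0) ≠ 0 := by exact_mod_cast (by omega : residueCard L ≠ 0)
  rw [augNorm, hW, hflow, Matrix.smul_mul, minorNorm_smul hq, absVal_uniformizer_pow hq hϖ,
    inv_pow, ← pow_mul, ← mul_assoc, mul_inv_cancel₀ (pow_ne_zero _ hq0), one_mul]
  exact minorNorm_mul_le hq _ _ hPint

end Flow

open scoped BigOperators

/-! ### Averages over finite abelian groups. -/

section Average

lemma card_ker_mul_card_range {G H : Type*} [AddCommGroup G] [AddCommGroup H] (φ : G →+ H) :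
    Nat.card φ.ker * Nat.card φ.range = Nat.card G := by
  rw [← AddSubgroup.index_ker, AddSubgroup.card_mul_index]

variable {G H : Type*} [AddCommGroup G] [Fintype G] [AddCommGroup H] [Fintype H]

lemma sum_comp_addMonoidHom (φ : G →+ H) (f : H → ℝ≥0) (hf : ∀ y, y ∉ φ.range → f y = 0) :
    ∑ x, f (φ x) = (Nat.card φ.ker : ℝ≥0) * ∑ y, f y := by
  classical
  rw [← Finset.sum_fiberwise Finset.univ φ, Finset.mul_sum]
  refine Finset.sum_congr rfl fun y _ => ?_
  rw [Finset.sum_congr rfl (g := fun _ => f y) fun x hx => by rw [(Finset.mem_filter.1 hx).2],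
    Finset.sum_const, nsmul_eq_mul]
  by_cases hy : y ∈ φ.range
  · congr 2
    rw [AddMonoidHom.card_fiber_eq_of_mem_range φ (y := 0) hy ⟨0, map_zero φ⟩,
      Nat.card_eq_fintype_card, Fintype.card_subtype]
    congr 1
    ext x
    simp [AddMonoidHom.mem_ker]
  · rw [hf y hy, mul_zero, mul_zero]

lemma expect_comp_addMonoidHom (φ : G →+ H) (hφ : Function.Surjective φ) (f : H → ℝ≥0) :
    𝔼 x, f (φ x) = 𝔼 y, f y := by
  have hr : φ.range = ⊤ := AddMonoidHom.range_eq_top.2 hφ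
  have h1 := card_ker_mul_card_range φ
  rw [hr, Nat.card_congr (AddSubgroup.topEquiv (G := H)).toEquiv] at h1
  rw [Fintype.expect_eq_sum_div_card, Fintype.expect_eq_sum_div_card,
    sum_comp_addMonoidHom φ f fun y hy => by simp [hr] at hy,
    ← Nat.card_eq_fintype_card (α := G), ← h1, ← Nat.card_eq_fintype_card (α := H), Nat.cast_mul]
  refine mul_div_mul_left _ _ ?_
  exact_mod_cast (Nat.card_pos (α := φ.ker)).ne'

/-- The average over the kernel of `ψ` when this is the image of an endomorphism `φ`. -/
lemma expect_ite_ker (φ : G →+ G) (ψ : G →+ H) (hψ : Function.Surjective ψ)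
    (h : φ.range = ψ.ker) (f : G → ℝ≥0) [DecidablePred fun x => ψ x = 0] :
    𝔼 x, (if ψ x = 0 then f x else 0) = (Fintype.card H : ℝ≥0)⁻¹ * 𝔼 x, f (φ x) := by
  have hr : ψ.range = ⊤ := AddMonoidHom.range_eq_top.2 hψ
  have h1 := card_ker_mul_card_range ψ
  have h2 := card_ker_mul_card_range φ
  rw [hr, Nat.card_congr (AddSubgroup.topEquiv (G := H)).toEquiv] at h1
  -- Both |ker φ| · |range φ| and |ker ψ| · |H| equal |G|, and range φ = ker ψ.
  have h3 : Nat.card φ.ker = Nat.card H := by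
    rw [← h1, h, mul_comm] at h2
    exact Nat.eq_of_mul_eq_mul_left (Nat.card_pos (α := ψ.ker)) h2
  have h4 := sum_comp_addMonoidHom φ (fun x => if ψ x = 0 then f x else 0) fun y hy => by
    rw [h] at hy
    exact if_neg hy
  have h5 : ∀ x, ψ (φ x) = 0 := fun x => by
    have : φ x ∈ ψ.ker := h ▸ ⟨x, rfl⟩
    exact this
  simp only [h5, if_true] at h4
  have h6 : (Fintype.card H : ℝ≥0) ≠ 0 := by exact_mod_cast Fintype.card_ne_zero
  rw [Fintype.expect_eq_sum_div_card, Fintype.expect_eq_sum_div_card, h4, h3,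
    Nat.card_eq_fintype_card]
  field_simp

end Average

/-! ### The recursive moment bound for kernel sizes. -/

section KernelMoment

/-- The shear replacing the lower right block of a matrix by its Schur complement. -/
def schurShear {R : Type*} [CommRing R] {m i : ℕ} :
    Matrix (Fin (m + 1)) (Fin (i + 1)) R ≃ Matrix (Fin (m + 1)) (Fin (i + 1)) R where
  toFun U := Matrix.of fun x y => U x y - if x = 0 ∨ y = 0 then 0 else
    U x 0 * Ring.inverse (U 0 0) * U 0 y
  invFun U := Matrix.of fun x y => U x y + if x = 0 ∨ y = 0 then 0 else
    U x 0 * Ring.inverse (U 0 0) * U 0 y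
  left_inv U := by ext; simp
  right_inv U := by ext; simp

/-- `schurShear` alters the lower right block by a quantity depending only on row 0 and column 0,
hence is a bijection. `Ring.inverse` vanishes at non-units, so no condition on the pivot is needed
and the Schur complement of a uniform matrix is uniform. -/
lemma expect_schurCompl {R : Type*} [CommRing R] [Fintype R] {m i : ℕ}
    (f : Matrix (Fin m) (Fin i) R → ℝ≥0) :
    𝔼 U : Matrix (Fin (m + 1)) (Fin (i + 1)) R, f (schurCompl U) = 𝔼 X, f X := by
  let φ : Matrix (Fin (m + 1)) (Fin (i + 1)) R →+ Matrix (Fin m) (Fin i) R :=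
    { toFun := fun U => U.submatrix Fin.succ Fin.succ
      map_zero' := rfl
      map_add' := fun _ _ => rfl }
  have hφ : Function.Surjective φ := fun X => by
    refine ⟨Matrix.of (Fin.cons 0 fun x => Fin.cons 0 fun y => X x y), ?_⟩
    rfl
  rw [← expect_comp_addMonoidHom φ hφ]
  refine Fintype.expect_equiv schurShear _ _ fun U => ?_
  congr 1

/-- The constant in the bound for the moments of `kernelSize`. -/
def momentConst (s : ℕ) : ℕ → ℝ≥0
  | 0 => 1
  | i + 1 => 2 * (((s + i + 1 : ℕ) : ℝ≥0) * ((i + 1 : ℕ) : ℝ≥0) * momentConst s i) + 1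

variable {R k : Type*} [CommRing R] [Fintype R] [Field k] [Fintype k] (red : R →+* k) (ϖ : R)
  (N : ℕ) (h : ∀ (_T : ℕ) {m i : ℕ}, Matrix (Fin m) (Fin i) R → ℝ≥0)

/-- The properties of `kernelSize` as a function on matrices over `𝒪 / ϖᴺ`. -/
structure IsKernelSize : Prop where
  surj : Function.Surjective red
  map_uniformizer : red ϖ = 0
  dvd_of_map_eq_zero : ∀ x, red x = 0 → ϖ ∣ x
  le : ∀ T m i (X : Matrix (Fin m) (Fin i) R), T ≤ N → h T X ≤ (Fintype.card k : ℝ≥0) ^ (T * i)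
  smul : ∀ T m i (X : Matrix (Fin m) (Fin i) R), T + 1 ≤ N →
    h (T + 1) (ϖ • X) ≤ (Fintype.card k : ℝ≥0) ^ i * h T X
  perm : ∀ T m i (X : Matrix (Fin m) (Fin i) R) (e₁ : Fin m ≃ Fin m) (e₂ : Fin i ≃ Fin i), T ≤ N →
    h T (X.submatrix e₁ e₂) = h T X
  schur : ∀ T m i (U : Matrix (Fin (m + 1)) (Fin (i + 1)) R), T ≤ N → red (U 0 0) ≠ 0 →
    h T U ≤ h T (schurCompl U)

variable {red ϖ N} {h}

/-- A swap of rows and of columns carries the unit entry to the corner, where passing to the Schur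
complement does not decrease `h`. -/
lemma IsKernelSize.expect_entry_le (H : IsKernelSize red ϖ N h) {T m i e : ℕ} (hT : T ≤ N)
    (a : Fin (m + 1)) (b : Fin (i + 1)) [DecidableEq k] :
    𝔼 X : Matrix (Fin (m + 1)) (Fin (i + 1)) R, (if red (X a b) = 0 then 0 else h T X ^ e) ≤
      𝔼 X : Matrix (Fin m) (Fin i) R, h T X ^ e := by
  let E : Matrix (Fin (m + 1)) (Fin (i + 1)) R ≃ Matrix (Fin (m + 1)) (Fin (i + 1)) R :=
    Matrix.reindex (Equiv.swap 0 a) (Equiv.swap 0 b)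
  have hE : 𝔼 X : Matrix (Fin (m + 1)) (Fin (i + 1)) R,
      (if red (X a b) = 0 then 0 else h T X ^ e) =
      𝔼 X : Matrix (Fin (m + 1)) (Fin (i + 1)) R,
      (if red (X 0 0) = 0 then 0 else h T X ^ e) := by
    refine Fintype.expect_equiv E _ _ fun X => ?_
    have h1 : E X 0 0 = X a b := by simp [E]
    have h2 : h T (E X) = h T X := H.perm T _ _ X _ _ hT
    rw [h1, h2]
  rw [hE, ← expect_schurCompl fun X => h T X ^ e]
  refine Finset.expect_le_expect fun X _ => ?_
  split_ifs with h0
  · exact zero_le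
  · gcongr
    exact H.schur T m i X hT h0

/-- The matrices vanishing in the residue field are the multiples of ϖ, a proportion |k|^{-mi} of
all; removing ϖ lowers the level by one at the cost of a factor |k|ⁱ in `h`. -/
lemma IsKernelSize.expect_dvd_le (H : IsKernelSize red ϖ N h) {T m i e : ℕ} (hT : T + 1 ≤ N)
    [DecidableEq k] :
    𝔼 X : Matrix (Fin m) (Fin i) R, (if X.map red = 0 then h (T + 1) X ^ e else 0) ≤
      ((Fintype.card k : ℝ≥0) ^ (m * i))⁻¹ * ((Fintype.card k : ℝ≥0) ^ (i * e) *
        𝔼 X : Matrix (Fin m) (Fin i) R, h T X ^ e) := by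
  let ψ : Matrix (Fin m) (Fin i) R →+ Matrix (Fin m) (Fin i) k := red.toAddMonoidHom.mapMatrix
  let φ : Matrix (Fin m) (Fin i) R →+ Matrix (Fin m) (Fin i) R :=
    DistribSMul.toAddMonoidHom _ ϖ
  have hψ : Function.Surjective ψ := fun Y => by
    choose g hg using H.surj
    refine ⟨Y.map g, ?_⟩
    ext x y
    simp [ψ, hg]
  have hφψ : φ.range = ψ.ker := by
    ext X
    constructor
    · rintro ⟨U, rfl⟩
      ext x y
      simp [φ, ψ, H.map_uniformizer]
    · intro hX
      have h1 : ∀ x y, ∃ u, X x y = ϖ * u := fun x y =>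
        H.dvd_of_map_eq_zero _ (congrFun (congrFun hX x) y)
      choose u hu using h1
      refine ⟨Matrix.of u, ?_⟩
      ext x y
      simp [φ, hu]
  have h1 := expect_ite_ker φ ψ hψ hφψ fun X => h (T + 1) X ^ e
  refine h1.le.trans ?_
  have hcard : (Fintype.card (Matrix (Fin m) (Fin i) k) : ℝ≥0) =
      (Fintype.card k : ℝ≥0) ^ (m * i) := by
    rw [Fintype.card_congr (Matrix.of (m := Fin m) (n := Fin i) (α := k)).symm]
    simp [← pow_mul, mul_comm m i]
  rw [hcard]
  refine mul_le_mul' le_rfl ?_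
  rw [Finset.mul_expect]
  refine Finset.expect_le_expect fun X _ => ?_
  rw [pow_mul, ← mul_pow]
  gcongr
  exact H.smul T m i X hT

/-- A union bound over the position of a unit entry, plus the case with none. With s+i+1 rows and
i+1 columns the exponent s+1 leaves |k|^{-(s+i+1)(i+1)+(i+1)(s+1)} = |k|^{-i(i+1)}, independent of
s. -/
lemma IsKernelSize.expect_succ_le (H : IsKernelSize red ϖ N h) {T s i : ℕ} (hT : T + 1 ≤ N) :
    𝔼 X : Matrix (Fin (s + (i + 1))) (Fin (i + 1)) R, h (T + 1) X ^ (s + 1) ≤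
      ((s + i + 1 : ℕ) : ℝ≥0) * ((i + 1 : ℕ) : ℝ≥0) *
        (𝔼 X : Matrix (Fin (s + i)) (Fin i) R, h (T + 1) X ^ (s + 1)) +
      ((Fintype.card k : ℝ≥0) ^ (i * (i + 1)))⁻¹ *
        𝔼 X : Matrix (Fin (s + (i + 1))) (Fin (i + 1)) R, h T X ^ (s + 1) := by
  classical
  have hpt : ∀ X : Matrix (Fin (s + (i + 1))) (Fin (i + 1)) R, h (T + 1) X ^ (s + 1) ≤
      (∑ a, ∑ b, if red (X a b) = 0 then 0 else h (T + 1) X ^ (s + 1)) +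
      (if X.map red = 0 then h (T + 1) X ^ (s + 1) else 0) := by
    intro X
    by_cases hX : X.map red = 0
    · rw [if_pos hX]
      exact le_add_self
    · have : ∃ a b, red (X a b) ≠ 0 := by
        by_contra! hc
        exact hX (by ext a b; simpa using hc a b)
      obtain ⟨a, b, hab⟩ := this
      refine le_add_right ?_
      refine le_trans ?_ (Finset.single_le_sum (fun _ _ => zero_le) (Finset.mem_univ a))
      refine le_trans ?_ (Finset.single_le_sum (fun _ _ => zero_le) (Finset.mem_univ b))
      rw [if_neg hab]
  refine (Finset.expect_le_expect fun X _ => hpt X).trans ?_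
  rw [Finset.expect_add_distrib]
  refine add_le_add ?_ ?_
  · rw [Finset.expect_sum_comm]
    simp_rw [Finset.expect_sum_comm]
    calc _ ≤ ∑ _a : Fin (s + (i + 1)), ∑ _b : Fin (i + 1),
          𝔼 X : Matrix (Fin (s + i)) (Fin i) R, h (T + 1) X ^ (s + 1) :=
          Finset.sum_le_sum fun a _ => Finset.sum_le_sum fun b _ =>
            H.expect_entry_le (m := s + i) hT a b
      _ = _ := by
          simp only [Finset.sum_const, Finset.card_univ, Fintype.card_fin, nsmul_eq_mul]
          push_cast; ring
  · refine (H.expect_dvd_le hT).trans (le_of_eq ?_)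
    have hk : (Fintype.card k : ℝ≥0) ≠ 0 := by exact_mod_cast Fintype.card_ne_zero
    rw [← mul_assoc]
    congr 1
    have : (s + (i + 1)) * (i + 1) = i * (i + 1) + (i + 1) * (s + 1) := by ring
    rw [this, pow_add, mul_inv, mul_assoc, inv_mul_cancel₀ (pow_ne_zero _ hk), mul_one]

lemma IsKernelSize.expect_zero_le (H : IsKernelSize red ϖ N h) {m i e : ℕ} :
    𝔼 X : Matrix (Fin m) (Fin i) R, h 0 X ^ e ≤ 1 := by
  refine Finset.expect_le Finset.univ_nonempty fun X _ => pow_le_one₀ zero_le ?_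
  simpa using H.le 0 m i X (Nat.zero_le _)

/-- Double induction, on the number of columns and then on the level T. With no columns the bound is
constant in T. -/
lemma IsKernelSize.expect_le (H : IsKernelSize red ϖ N h) (s i : ℕ) :
    ∀ T ≤ N, 𝔼 X : Matrix (Fin (s + i)) (Fin i) R, h T X ^ (s + 1) ≤
      momentConst s i * (if i = 0 then 1 else (T : ℝ≥0) + 1) := by
  have hk : (2 : ℝ≥0) ≤ Fintype.card k := by exact_mod_cast Fintype.one_lt_card (α := k)
  induction i with
  | zero =>
    intro T hT
    refine (Finset.expect_le Finset.univ_nonempty fun X _ => pow_le_one₀ zero_le ?_).trans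
      (by simp [momentConst])
    simpa using H.le T _ 0 X hT
  | succ i ih =>
    intro T hT
    rw [if_neg (Nat.succ_ne_zero i)]
    induction T with
    | zero =>
      refine H.expect_zero_le.trans ?_
      simp [momentConst]
    | succ T ihT =>
      refine (H.expect_succ_le hT).trans ?_
      have h1 := ihT (by omega)
      have h2 := ih (T + 1) hT
      set c : ℝ≥0 := ((s + i + 1 : ℕ) : ℝ≥0) * ((i + 1 : ℕ) : ℝ≥0) with hc
      rcases i with _ | i
      -- One column: the recursion has ratio 1 and bounded increments, giving growth linear in T.
      · have hM1 : momentConst s (0 + 1) = 2 * (c * 1) + 1 := rfl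
        have hM0 : momentConst s 0 = 1 := rfl
        rw [hM1, mul_one] at h1 ⊢
        rw [hM0, if_pos rfl, mul_one] at h2
        calc _ ≤ c * 1 + 1 * ((2 * c + 1) * ((T : ℝ≥0) + 1)) := by
              gcongr
              · simp
          _ ≤ _ := by
              push_cast
              have : c * 1 + 1 * ((2 * c + 1) * ((T : ℝ≥0) + 1)) + (c + 1) =
                (2 * c + 1) * ((T : ℝ≥0) + 1 + 1) := by ring
              rw [← this]
              exact le_self_add
      · rw [if_neg (Nat.succ_ne_zero i)] at h2
        set M := momentConst s (i + 1) with hM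
        have hM2 : momentConst s (i + 1 + 1) = 2 * (c * M) + 1 := rfl
        rw [hM2] at h1 ⊢
        -- At least two columns: the ratio is at most 1/2, so the linear bound for one column fewer
        -- is only multiplied by a constant. The 2 in `momentConst` compensates for this ratio.
        have hq : ((Fintype.card k : ℝ≥0) ^ ((i + 1) * (i + 1 + 1)))⁻¹ ≤ 2⁻¹ := by
          gcongr
          calc (2 : ℝ≥0) ≤ Fintype.card k := hk
            _ ≤ _ := le_self_pow₀ (one_le_two.trans hk) (by positivity)
        calc _ ≤ c * (M * (((T + 1 : ℕ) : ℝ≥0) + 1)) +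
              2⁻¹ * ((2 * (c * M) + 1) * ((T : ℝ≥0) + 1)) := by gcongr
          _ ≤ _ := by
            push_cast
            have h2 : (2 : ℝ≥0)⁻¹ * 2 = 1 := by norm_num
            have : c * (M * ((T : ℝ≥0) + 1 + 1)) + 2⁻¹ * ((2 * (c * M) + 1) * ((T : ℝ≥0) + 1)) +
                (c * M + 1 + 2⁻¹ * (T + 1)) = (2 * (c * M) + 1) * ((T : ℝ≥0) + 1 + 1) := by
              have h3 : 2⁻¹ * ((2 * (c * M) + 1) * ((T : ℝ≥0) + 1)) =
                (2⁻¹ * 2) * (c * M * (T + 1)) + 2⁻¹ * (T + 1) := by ring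
              rw [h3, h2]
              have h4 : ((T : ℝ≥0) + 1) = 2⁻¹ * 2 * ((T : ℝ≥0) + 1) := by rw [h2, one_mul]
              have h5 : (2 : ℝ≥0)⁻¹ * (T + 1) + 2⁻¹ * (T + 1) = T + 1 := by
                calc _ = 2⁻¹ * 2 * ((T : ℝ≥0) + 1) := by ring
                  _ = _ := h4.symm
              calc _ = 2 * (c * M) * (T + 1 + 1) + 1 + (2⁻¹ * (T + 1) + 2⁻¹ * (T + 1)) := by ring
                _ = _ := by rw [h5]; ring
            rw [← this]
            exact le_self_add

end KernelMoment

/-! ### Reduction to the finite rings 𝒪/ϖᴺ. -/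

section Quotient

variable {L : Type*} [Field L] [Valued L ℤᵐ⁰]

lemma isUnit_of_valued_eq_one {x : Valued.integer L} (hx : (Valued.v (x : L) : ℤᵐ⁰) = 1) :
    IsUnit x := by
  have h0 : (x : L) ≠ 0 := by
    intro h
    rw [h, map_zero] at hx
    exact zero_ne_one hx
  refine IsUnit.of_mul_eq_one ⟨(x : L)⁻¹, ?_⟩ ?_
  · change (Valued.v (x : L)⁻¹ : ℤᵐ⁰) ≤ 1
    rw [map_inv₀, hx, inv_one]
  · ext
    exact mul_inv_cancel₀ h0

variable {ϖ : Valued.integer L} (hϖ : (Valued.v (ϖ : L) : ℤᵐ⁰) = WithZero.exp (-1))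

include hϖ in
lemma uniformizer_dvd_of_not_isUnit {x : Valued.integer L} (hx : ¬ IsUnit x) : ϖ ∣ x := by
  have h0 : (ϖ : L) ≠ 0 := uniformizer_ne_zero hϖ
  rcases eq_or_ne (x : L) 0 with hx0 | hx0
  · have : x = 0 := Subtype.ext hx0
    rw [this]
    exact dvd_zero _
  have hlt : (Valued.v (x : L) : ℤᵐ⁰) < 1 :=
    lt_of_le_of_ne x.2 fun h => hx (isUnit_of_valued_eq_one h)
  have hv0 : (Valued.v (x : L) : ℤᵐ⁰) ≠ 0 := (Valuation.ne_zero_iff _).2 hx0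
  have hle : (Valued.v (x : L) : ℤᵐ⁰) ≤ Valued.v (ϖ : L) := by
    rw [hϖ, ← WithZero.exp_log hv0, WithZero.exp_le_exp]
    rw [← WithZero.exp_log hv0, ← WithZero.exp_zero, WithZero.exp_lt_exp] at hlt
    omega
  refine ⟨⟨(x : L) / ϖ, ?_⟩, ?_⟩
  · change (Valued.v ((x : L) / ϖ) : ℤᵐ⁰) ≤ 1
    rw [map_div₀]
    exact div_le_one_of_le₀ hle zero_le
  · ext
    exact (mul_div_cancel₀ _ h0).symm

include hϖ in
lemma residue_uniformizer : IsLocalRing.residue (Valued.integer L) ϖ = 0 := by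
  rw [IsLocalRing.residue_eq_zero_iff, IsLocalRing.mem_maximalIdeal, mem_nonunits_iff]
  rintro ⟨u, hu⟩
  have h1 : (Valued.v ((ϖ : L)⁻¹) : ℤᵐ⁰) ≤ 1 := by
    have h2 : ((u⁻¹ : (Valued.integer L)ˣ) : L) = (ϖ : L)⁻¹ := by
      apply eq_inv_of_mul_eq_one_left
      rw [← hu, ← Subring.coe_mul, Units.inv_mul, Subring.coe_one]
    rw [← h2]
    exact ((u⁻¹ : (Valued.integer L)ˣ) : Valued.integer L).2
  rw [map_inv₀, hϖ, ← WithZero.exp_neg, ← WithZero.exp_zero, WithZero.exp_le_exp] at h1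
  omega

/-- The quotient `𝒪 / ϖᴺ`. -/
abbrev TruncInt (ϖ : Valued.integer L) (N : ℕ) : Type _ :=
  Valued.integer L ⧸ (Ideal.span {ϖ}) ^ N

include hϖ in
lemma span_uniformizer :
    Ideal.span {ϖ} = IsLocalRing.maximalIdeal (Valued.integer L) := by
  apply le_antisymm
  · rw [Ideal.span_singleton_le_iff_mem, ← IsLocalRing.residue_eq_zero_iff]
    exact residue_uniformizer hϖ
  · intro x hx
    exact Ideal.mem_span_singleton.2 (uniformizer_dvd_of_not_isUnit hϖ hx)

include hϖ in
lemma finite_truncInt [Finite (IsLocalRing.ResidueField (Valued.integer L))] (N : ℕ) :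
    Finite (TruncInt ϖ N) := by
  have : Finite (Valued.integer L ⧸ Ideal.span {ϖ}) := by
    rw [span_uniformizer hϖ]
    exact inferInstanceAs (Finite (IsLocalRing.ResidueField (Valued.integer L)))
  exact Ideal.finite_quotient_pow (Submodule.fg_span_singleton ϖ) N

/-- The reduction `𝒪 / ϖᴺ → k` for `N ≥ 1`. -/
def truncResidue (N : ℕ) (hN : N ≠ 0) :
    TruncInt ϖ N →+* IsLocalRing.ResidueField (Valued.integer L) :=
  Ideal.Quotient.lift _ (IsLocalRing.residue (Valued.integer L)) fun x hx => by
    have h1 : x ∈ Ideal.span {ϖ} := Ideal.pow_le_self hN hx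
    rw [span_uniformizer hϖ] at h1
    exact (IsLocalRing.residue_eq_zero_iff x).2 h1

/-- `kernelSize` as a function on matrices over `𝒪 / ϖᴺ`. -/
def truncKernelSize (ϖ : Valued.integer L) (N T : ℕ) {m i : ℕ}
    (X : Matrix (Fin m) (Fin i) (TruncInt ϖ N)) : ℝ≥0 :=
  kernelSize (ϖ : L) T (X.map fun x => ((Function.surjInv Ideal.Quotient.mk_surjective x :
    Valued.integer L) : L))

include hϖ in
-- Two lifts differ by a multiple of ϖᴺ, hence of ϖᵀ, to which `kernelSize` at level T is
-- insensitive.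
lemma truncKernelSize_mk (hq : 1 < residueCard L) {N T : ℕ} (hT : T ≤ N) {m i : ℕ}
    (X : Matrix (Fin m) (Fin i) (Valued.integer L)) :
    truncKernelSize ϖ N T (X.map (Ideal.Quotient.mk ((Ideal.span {ϖ}) ^ N))) =
      kernelSize (ϖ : L) T (X.map fun x => (x : L)) := by
  set g : TruncInt ϖ N → Valued.integer L := Function.surjInv Ideal.Quotient.mk_surjective with hg
  have h1 : ∀ x y, ∃ z : Valued.integer L,
      g (Ideal.Quotient.mk ((Ideal.span {ϖ}) ^ N) (X x y)) - X x y = ϖ ^ T * z := by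
    intro x y
    have h2 : Ideal.Quotient.mk ((Ideal.span {ϖ}) ^ N)
        (g (Ideal.Quotient.mk ((Ideal.span {ϖ}) ^ N) (X x y))) =
        Ideal.Quotient.mk ((Ideal.span {ϖ}) ^ N) (X x y) :=
      Function.surjInv_eq Ideal.Quotient.mk_surjective _
    rw [Ideal.Quotient.eq] at h2
    exact (pow_dvd_pow ϖ hT).trans
      (Ideal.mem_span_singleton.1 ((Ideal.span_singleton_pow ϖ N).le h2))
  choose z hz using h1
  have h3 : ((X.map (Ideal.Quotient.mk ((Ideal.span {ϖ}) ^ N))).map fun x => ((g x :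
      Valued.integer L) : L)) = (X.map fun x => (x : L)) +
      (ϖ : L) ^ T • (Matrix.of z).map fun x => (x : L) := by
    ext x y
    have h4 := congrArg (fun a : Valued.integer L => (a : L)) (hz x y)
    simp only [AddSubgroupClass.coe_sub, Subring.coe_mul, Subring.coe_pow] at h4
    simp only [Matrix.map_apply, Matrix.add_apply, Matrix.smul_apply, Matrix.of_apply, smul_eq_mul]
    rw [← h4]
    ring
  rw [truncKernelSize, ← hg, h3]
  exact kernelSize_add hq (uniformizer_ne_zero hϖ) T _ _ fun x y => absVal_coe_le_one hq _

lemma schurCompl_map {R S : Type*} [CommRing R] [CommRing S] (φ : R →+* S) {m i : ℕ}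
    (U : Matrix (Fin (m + 1)) (Fin (i + 1)) R) (hU : IsUnit (U 0 0)) :
    schurCompl (U.map φ) = (schurCompl U).map φ := by
  have h : Ring.inverse (φ (U 0 0)) = φ (Ring.inverse (U 0 0)) := by
    obtain ⟨u, hu⟩ := hU
    rw [← hu, Ring.inverse_unit]
    exact Ring.inverse_unit (Units.map (φ : R →* S) u)
  ext x y
  simp [schurCompl, h]

lemma exists_eq_map_mk {N m i : ℕ} (X : Matrix (Fin m) (Fin i) (TruncInt ϖ N)) :
    ∃ Y : Matrix (Fin m) (Fin i) (Valued.integer L),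
      X = Y.map (Ideal.Quotient.mk ((Ideal.span {ϖ}) ^ N)) := by
  refine ⟨X.map (Function.surjInv Ideal.Quotient.mk_surjective), ?_⟩
  ext x y
  exact (Function.surjInv_eq Ideal.Quotient.mk_surjective _).symm

lemma isKernelSize_truncKernelSize [Fintype (IsLocalRing.ResidueField (Valued.integer L))]
    (hq : 1 < residueCard L) (N : ℕ) (hN : N ≠ 0) [Fintype (TruncInt ϖ N)] :
    IsKernelSize (truncResidue hϖ N hN) (Ideal.Quotient.mk ((Ideal.span {ϖ}) ^ N) ϖ) N
      (truncKernelSize ϖ N) where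
  surj := Ideal.Quotient.lift_surjective_of_surjective _ _ IsLocalRing.residue_surjective
  map_uniformizer := residue_uniformizer hϖ
  dvd_of_map_eq_zero x hx := by
    obtain ⟨x, rfl⟩ := Ideal.Quotient.mk_surjective x
    have h1 : IsLocalRing.residue (Valued.integer L) x = 0 := hx
    rw [IsLocalRing.residue_eq_zero_iff, ← span_uniformizer hϖ, Ideal.mem_span_singleton] at h1
    exact map_dvd _ h1
  le T m i X hT := by
    rw [← Nat.card_eq_fintype_card]
    exact kernelSize_le T _
  smul T m i X hT := by
    obtain ⟨X, rfl⟩ := exists_eq_map_mk X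
    have h1 : Ideal.Quotient.mk ((Ideal.span {ϖ}) ^ N) ϖ •
        X.map (Ideal.Quotient.mk ((Ideal.span {ϖ}) ^ N)) =
        (ϖ • X).map (Ideal.Quotient.mk ((Ideal.span {ϖ}) ^ N)) := by
      ext x y
      simp
    have h2 : ((ϖ • X).map fun x => (x : L)) = (ϖ : L) • (X.map fun x => (x : L)) := by
      ext x y
      simp
    rw [h1, truncKernelSize_mk hϖ hq hT, truncKernelSize_mk hϖ hq (by omega), h2,
      kernelSize_uniformizer_smul (uniformizer_ne_zero hϖ), ← Nat.card_eq_fintype_card]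
    rfl
  perm T m i X e₁ e₂ hT := by
    obtain ⟨X, rfl⟩ := exists_eq_map_mk X
    rw [Matrix.submatrix_map, truncKernelSize_mk hϖ hq hT, truncKernelSize_mk hϖ hq hT,
      ← Matrix.submatrix_map, kernelSize_submatrix]
  schur T m i U hT hU := by
    obtain ⟨U, rfl⟩ := exists_eq_map_mk U
    have hunit : IsUnit (U 0 0) := by
      by_contra hc
      exact hU ((IsLocalRing.residue_eq_zero_iff _).2 hc)
    rw [schurCompl_map _ U hunit, truncKernelSize_mk hϖ hq hT, truncKernelSize_mk hϖ hq hT]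
    refine (kernelSize_le_schurCompl hq hϖ T (U.map fun x => (x : L))
      (absVal_coe_eq_one hq hunit)).trans_eq ?_
    exact congrArg _ (schurCompl_map (Valued.integer L).subtype U hunit)

end Quotient

/-! ### Uniform distribution of blocks and the density of invertible matrices. -/

section Count

variable {R k : Type*} [CommRing R] [Fintype R] [Field k] [Fintype k]

omit [Fintype R] in
lemma one_submatrix_mul {d i : ℕ} (f : Fin i → Fin d) (V : Matrix (Fin d) (Fin i) R) :
    (1 : Matrix (Fin d) (Fin d) R).submatrix f id * V = V.submatrix f id := by
  ext a b
  change ((1 : Matrix (Fin d) (Fin d) R) * V) (f a) b = _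
  rw [Matrix.one_mul]
  rfl

/-- If `V` has an identity block and `A` is uniformly distributed, then so is the block formed by
the first rows of `A * V`. -/
lemma expect_mul_right {m n i : ℕ} (V : Matrix (Fin (m + n)) (Fin i) R) (f : Fin i → Fin (m + n))
    (hV : V.submatrix f id = 1) (F : Matrix (Fin m) (Fin i) R → ℝ≥0) :
    𝔼 A : Matrix (Fin (m + n)) (Fin (m + n)) R, F ((A * V).submatrix (Fin.castAdd n) id) =
      𝔼 X, F X := by
  let φ : Matrix (Fin (m + n)) (Fin (m + n)) R →+ Matrix (Fin m) (Fin i) R :=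
    { toFun := fun A => (A * V).submatrix (Fin.castAdd n) id
      map_zero' := by simp
      map_add' := fun A B => by rw [Matrix.add_mul]; rfl }
  refine expect_comp_addMonoidHom φ (fun X => ?_) F
  refine ⟨Matrix.of fun r => Fin.addCases (fun x => (X *
    (1 : Matrix (Fin (m + n)) (Fin (m + n)) R).submatrix f id) x) (fun _ => 0) r, ?_⟩
  ext x y
  have h1 : (1 : Matrix (Fin (m + n)) (Fin (m + n)) R).submatrix f id * V = 1 := by
    rw [one_submatrix_mul, hV]
  have h2 : (X * ((1 : Matrix (Fin (m + n)) (Fin (m + n)) R).submatrix f id * V)) x y = X x y := by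
    rw [h1, Matrix.mul_one]
  rw [← h2, ← Matrix.mul_assoc]
  simp [φ, Matrix.mul_apply]

/-- In |GL_d(k)| = ∏ⱼ (qᵈ − qʲ) with j < d, each factor is at least qᵈ/2. -/
lemma card_pow_le_card_det_ne_zero [DecidableEq k] (d : ℕ) :
    (Fintype.card k) ^ (d * d) ≤
      2 ^ d * (Finset.univ.filter fun B : Matrix (Fin d) (Fin d) k => B.det ≠ 0).card := by
  have h1 : (Finset.univ.filter fun B : Matrix (Fin d) (Fin d) k => B.det ≠ 0).card =
      Nat.card (Matrix.GeneralLinearGroup (Fin d) k) := by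
    rw [← Fintype.card_subtype, ← Nat.card_eq_fintype_card]
    refine Nat.card_congr (Equiv.ofBijective
      (fun g : Matrix.GeneralLinearGroup (Fin d) k =>
        (⟨g.1, ?_⟩ : {B : Matrix (Fin d) (Fin d) k // B.det ≠ 0})) ⟨?_, ?_⟩).symm
    · exact (Matrix.isUnit_iff_isUnit_det _).1 ⟨g, rfl⟩ |>.ne_zero
    · intro g g' h
      exact Units.ext (congrArg Subtype.val h)
    · rintro ⟨B, hB⟩
      obtain ⟨u, hu⟩ := (Matrix.isUnit_iff_isUnit_det B).2 (isUnit_iff_ne_zero.2 hB)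
      exact ⟨u, Subtype.ext hu⟩
  rw [h1, Matrix.card_GL_field, pow_mul]
  have h2 : ∀ j : Fin d, Fintype.card k ^ d ≤
      2 * (Fintype.card k ^ d - Fintype.card k ^ (j : ℕ)) := fun j => by
    have hk : 2 ≤ Fintype.card k := Fintype.one_lt_card (α := k)
    have h3 : 2 * Fintype.card k ^ (j : ℕ) ≤ Fintype.card k ^ d :=
      calc _ ≤ Fintype.card k * Fintype.card k ^ (j : ℕ) := Nat.mul_le_mul_right _ hk
        _ = Fintype.card k ^ ((j : ℕ) + 1) := (pow_succ' _ _).symm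
        _ ≤ _ := Nat.pow_le_pow_right (by omega) j.2
    omega
  calc (Fintype.card k ^ d) ^ d = ∏ _j : Fin d, Fintype.card k ^ d := by simp
    _ ≤ ∏ j : Fin d, 2 * (Fintype.card k ^ d - Fintype.card k ^ (j : ℕ)) :=
        Finset.prod_le_prod' fun j _ => h2 j
    _ = _ := by rw [Finset.prod_mul_distrib]; simp

/-- The proportion of invertible matrices is bounded below. -/
lemma card_le_card_det_ne_zero [DecidableEq k] (red : R →+* k) (hred : Function.Surjective red)
    (d : ℕ) :
    (Fintype.card (Matrix (Fin d) (Fin d) R) : ℝ≥0) ≤ 2 ^ d *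
      (Finset.univ.filter fun A : Matrix (Fin d) (Fin d) R => red A.det ≠ 0).card := by
  let ψ : Matrix (Fin d) (Fin d) R →+ Matrix (Fin d) (Fin d) k := red.toAddMonoidHom.mapMatrix
  have hψ : Function.Surjective ψ := fun Y => by
    choose g hg using hred
    refine ⟨Y.map g, ?_⟩
    ext x y
    simp [ψ, hg]
  have h1 := expect_comp_addMonoidHom ψ hψ fun B => if B.det ≠ 0 then 1 else 0
  have h2 : ∀ A, (ψ A).det = red A.det := fun A => (red.map_det A).symm
  simp only [h2] at h1
  rw [Fintype.expect_eq_sum_div_card, Fintype.expect_eq_sum_div_card, Finset.sum_boole,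
    Finset.sum_boole] at h1
  have hR : (Fintype.card (Matrix (Fin d) (Fin d) R) : ℝ≥0) ≠ 0 := by
    exact_mod_cast Fintype.card_ne_zero
  have hk : (Fintype.card (Matrix (Fin d) (Fin d) k) : ℝ≥0) ≠ 0 := by
    exact_mod_cast Fintype.card_ne_zero
  rw [div_eq_iff hR] at h1
  rw [h1, div_mul_eq_mul_div, ← mul_div_assoc, le_div_iff₀ (pos_iff_ne_zero.2 hk), mul_comm,
    ← mul_assoc]
  gcongr
  have hcard : Fintype.card (Matrix (Fin d) (Fin d) k) = Fintype.card k ^ (d * d) := by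
    rw [Fintype.card_congr (Matrix.of (m := Fin d) (n := Fin d) (α := k)).symm]
    simp [← pow_mul]
  rw [hcard]
  exact_mod_cast card_pow_le_card_det_ne_zero d

end Count

open MeasureTheory

/-- The lower integral is superadditive for arbitrary functions, so the integrand need not be shown
measurable. -/
lemma sum_lintegral_le {α ι : Type*} [MeasurableSpace α] (μ : Measure α) (s : Finset ι)
    (f : ι → α → ℝ≥0∞) : ∑ a ∈ s, ∫⁻ x, f a x ∂μ ≤ ∫⁻ x, ∑ a ∈ s, f a x ∂μ := by
  classical
  induction s using Finset.induction_on with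
  | empty => simp
  | insert a s ha ih =>
    simp only [Finset.sum_insert ha]
    exact (add_le_add le_rfl ih).trans (le_lintegral_add _ _)

/-! ### Finiteness of the residue field. -/

section ResidueField

variable {L : Type*} [Field L] [Valued L ℤᵐ⁰] {d : ℕ}

lemma isOpen_residue_eq (y : Valued.integer L) :
    IsOpen {x : Valued.integer L | IsLocalRing.residue _ x = IsLocalRing.residue _ y} := by
  have h1 : {x : Valued.integer L | IsLocalRing.residue _ x = IsLocalRing.residue _ y} =
      (fun x : Valued.integer L => (x : L) - y) ⁻¹' {z | (Valued.v z : ℤᵐ⁰) < 1} := by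
    ext x
    have h2 : IsLocalRing.residue _ x = IsLocalRing.residue _ y ↔ ¬ IsUnit (x - y) := by
      rw [← sub_eq_zero, ← map_sub, IsLocalRing.residue_eq_zero_iff]
      rfl
    rw [Set.mem_ofPred_eq, h2, Set.mem_preimage, Set.mem_ofPred_eq]
    constructor
    · intro h
      exact lt_of_le_of_ne (x - y).2 fun h3 => h (isUnit_of_valued_eq_one h3)
    · rintro h ⟨u, hu⟩
      have h3 : (Valued.v ((u : Valued.integer L) : L) : ℤᵐ⁰) < 1 := by
        rw [hu]; exact h
      have h4 : (Valued.v (((u⁻¹ : (Valued.integer L)ˣ) : Valued.integer L) : L) : ℤᵐ⁰) ≤ 1 :=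
        ((u⁻¹ : (Valued.integer L)ˣ) : Valued.integer L).2
      have h5 : (Valued.v ((u : Valued.integer L) : L) : ℤᵐ⁰) *
          Valued.v (((u⁻¹ : (Valued.integer L)ˣ) : Valued.integer L) : L) = 1 := by
        rw [← map_mul, ← Subring.coe_mul, Units.mul_inv]
        simp
      exact (mul_lt_one_of_lt_of_le h3 h4).ne h5
  have h6 : IsOpen {z : L | (Valued.v z : ℤᵐ⁰) < 1} := by
    simpa only [Valuation.restrict_lt_one_iff] using Valued.isOpen_ball L 1
  rw [h1]
  exact h6.preimage (continuous_subtype_val.sub continuous_const)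

lemma isOpen_setOf_map_residue_eq (g : SLInt d L) :
    IsOpen {k : SLInt d L | Matrix.SpecialLinearGroup.map (IsLocalRing.residue _) k =
      Matrix.SpecialLinearGroup.map (IsLocalRing.residue _) g} := by
  have h1 : {k : SLInt d L | Matrix.SpecialLinearGroup.map (IsLocalRing.residue _) k =
      Matrix.SpecialLinearGroup.map (IsLocalRing.residue _) g} =
      ⋂ a : Fin d, ⋂ b : Fin d, (fun k : SLInt d L => k.1 a b) ⁻¹'
        {x | IsLocalRing.residue _ x = IsLocalRing.residue _ (g.1 a b)} := by
    ext k
    simp only [Set.mem_ofPred_eq, Set.mem_iInter, Set.mem_preimage]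
    rw [Matrix.SpecialLinearGroup.ext_iff]
    rfl
  rw [h1]
  refine isOpen_iInter_of_finite fun a => isOpen_iInter_of_finite fun b => ?_
  exact (isOpen_residue_eq _).preimage (continuous_subtype_val.matrix_elem a b)

/-- If `SL_d(𝒪)` has a finite Haar measure for some `d ≥ 2`, then the residue field is finite. -/
lemma finite_residueField (hd : 2 ≤ d) [MeasurableSpace (SLInt d L)] [BorelSpace (SLInt d L)]
    (μ : Measure (SLInt d L)) [μ.IsHaarMeasure] [IsFiniteMeasure μ] :
    Finite (IsLocalRing.ResidueField (Valued.integer L)) := by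
  by_contra hfin
  rw [not_finite_iff_infinite] at hfin
  let ρ : SLInt d L →* Matrix.SpecialLinearGroup (Fin d) (IsLocalRing.ResidueField _) :=
    Matrix.SpecialLinearGroup.map (IsLocalRing.residue (Valued.integer L))
  let i0 : Fin d := ⟨0, by omega⟩
  let i1 : Fin d := ⟨1, by omega⟩
  have hi : i0 ≠ i1 := by simp [i0, i1]
  let e : Valued.integer L → SLInt d L := fun x =>
    ⟨Matrix.transvection i0 i1 x, Matrix.det_transvection_of_ne _ _ hi x⟩
  have he : ∀ x, (ρ (e x)).1 i0 i1 = IsLocalRing.residue _ x := fun x => by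
    change IsLocalRing.residue _ (Matrix.transvection i0 i1 x i0 i1) = _
    simp [Matrix.transvection, Matrix.one_apply_ne hi]
  let emb := Infinite.natEmbedding (IsLocalRing.ResidueField (Valued.integer L))
  choose x hx using fun j => IsLocalRing.residue_surjective (emb j)
  -- The congruence subgroup Γ is open, so it has positive measure. Transvections with distinct
  -- residues would give infinitely many disjoint translates of Γ, contradicting finiteness of the
  -- measure.
  let Γ : Set (SLInt d L) := {k | ρ k = ρ 1}
  have hΓ : IsOpen Γ := isOpen_setOf_map_residue_eq 1
  have hμ : μ Γ ≠ 0 := (hΓ.measure_pos μ ⟨1, rfl⟩).ne'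
  let S : ℕ → Set (SLInt d L) := fun j => (fun k => (e (x j))⁻¹ * k) ⁻¹' Γ
  have hS : ∀ j, ∀ k ∈ S j, ρ k = ρ (e (x j)) := fun j k hk => by
    have h1 : ρ ((e (x j))⁻¹ * k) = ρ 1 := hk
    rw [map_mul, map_inv, map_one] at h1
    exact (inv_mul_eq_one.1 h1).symm
  have hdisj : Pairwise (Function.onFun Disjoint S) := by
    intro j l hjl
    refine Set.disjoint_left.2 fun k hkj hkl => hjl ?_
    apply emb.injective
    rw [← hx j, ← hx l, ← he, ← he, ← hS j k hkj, ← hS l k hkl]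
  have hmeas : ∀ j, MeasurableSet (S j) := fun j =>
    (hΓ.preimage (continuous_const.mul continuous_id)).measurableSet
  have h1 := measure_iUnion (μ := μ) hdisj hmeas
  have h2 : ∀ j, μ (S j) = μ Γ := fun j => measure_preimage_mul μ _ Γ
  simp only [h2, ENNReal.tsum_const_eq_top_of_ne_zero hμ] at h1
  exact measure_ne_top μ _ h1

end ResidueField

/-! ### Pointwise lower bounds for the integrand's norm. -/

section Integral

variable {L : Type*} [Field L] [Valued L ℤᵐ⁰] {m n i : ℕ}

lemma toMatrix_mul {d : ℕ} (g k : SLInt d L) : (g * k).toMatrix = g.toMatrix * k.toMatrix :=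
  Matrix.map_mul (f := (Valued.integer L).subtype)

lemma toMatrix_one {d : ℕ} : (1 : SLInt d L).toMatrix = 1 :=
  Matrix.map_one (Valued.integer L).subtype rfl rfl

lemma minorNorm_le_minorNorm_toMatrix_mul (hq : 1 < residueCard L) {d : ℕ} (k : SLInt d L)
    (V : Matrix (Fin d) (Fin i) L) : minorNorm V ≤ minorNorm (k.toMatrix * V) := by
  have h := minorNorm_mul_le hq (k⁻¹).toMatrix (k.toMatrix * V) fun x y => absVal_coe_le_one hq _
  rwa [← Matrix.mul_assoc, ← toMatrix_mul, inv_mul_cancel, toMatrix_one, Matrix.one_mul] at h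

/-- An integral matrix with unit determinant can be replaced by one of determinant one without
decreasing the minors of its products with the diagonal flow. -/
lemma exists_SLInt_minorNorm_le (hq : 1 < residueCard L) (hm : 1 ≤ m) (ϖ : L) (t : ℤ)
    (A : Matrix (Fin (m + n)) (Fin (m + n)) (Valued.integer L)) (hA : IsUnit A.det) :
    ∃ g : SLInt (m + n) L, ∀ V : Matrix (Fin (m + n)) (Fin i) L,
      minorNorm (flow m n ϖ t * (A.map (fun x => (x : L)) * V)) ≤
        minorNorm (flow m n ϖ t * (g.toMatrix * V)) := by
  obtain ⟨u, hu⟩ := hA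
  let r : Fin (m + n) := ⟨0, by omega⟩
  -- Rescaling one row by (det A)⁻¹ corrects the determinant; the undoing matrix `D'` is integral
  -- and, being diagonal, commutes with the flow.
  set D : Matrix (Fin (m + n)) (Fin (m + n)) (Valued.integer L) :=
    Matrix.diagonal (Function.update 1 r ((u⁻¹ : (Valued.integer L)ˣ) : Valued.integer L)) with hD
  set D' : Matrix (Fin (m + n)) (Fin (m + n)) (Valued.integer L) :=
    Matrix.diagonal (Function.update 1 r (u : Valued.integer L)) with hD'
  have hDD : D' * D = 1 := by
    rw [hD, hD', Matrix.diagonal_mul_diagonal, ← Matrix.diagonal_one]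
    congr 1
    ext x
    by_cases hx : x = r
    · subst hx; simp
    · simp [hx]
  have hdet : (D * A).det = 1 := by
    rw [Matrix.det_mul, hD, Matrix.det_diagonal, Finset.prod_update_of_mem (Finset.mem_univ _), ← hu]
    simp
  refine ⟨⟨D * A, hdet⟩, fun V => ?_⟩
  set ι : Valued.integer L →+* L := (Valued.integer L).subtype with hι
  have h1 : A.map (fun x => (x : L)) = D'.map ι * (D * A).map ι := by
    rw [← Matrix.map_mul, ← Matrix.mul_assoc, hDD, Matrix.one_mul]
    rfl
  have h2 : flow m n ϖ t * D'.map ι = D'.map ι * flow m n ϖ t := by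
    rw [hD', Matrix.diagonal_map (map_zero ι), flow, Matrix.diagonal_mul_diagonal,
      Matrix.diagonal_mul_diagonal]
    congr 1
    ext x
    exact mul_comm _ _
  rw [h1, Matrix.mul_assoc, ← Matrix.mul_assoc, h2, Matrix.mul_assoc]
  exact minorNorm_mul_le hq _ _ fun x y => absVal_coe_le_one hq _

/-- Lower bound for the minors of `g_t * A * V` in terms of the kernel of the reduction of the
first rows of `A * V`. -/
lemma pow_mul_minorNorm_le (hq : 1 < residueCard L) {ϖ : L}
    (hϖ : (Valued.v ϖ : ℤᵐ⁰) = WithZero.exp (-1)) (t : ℕ)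
    (A : Matrix (Fin (m + n)) (Fin (m + n)) (Valued.integer L)) (hA : IsUnit A.det)
    (V : Matrix (Fin (m + n)) (Fin i) (Valued.integer L)) (f : Fin i → Fin (m + n))
    (hV : V.submatrix f id = 1) :
    (residueCard L : ℝ≥0) ^ (n * t * i) ≤
      kernelSize ϖ ((m + n) * t) (((A * V).submatrix (Fin.castAdd n) id).map fun x => (x : L)) *
        minorNorm (flow m n ϖ t * (A.map (fun x => (x : L)) * V.map fun x => (x : L))) := by
  set ι : Valued.integer L →+* L := (Valued.integer L).subtype with hι
  have hq0 : (residueCard L : ℝ≥0) ≠ 0 := by exact_mod_cast (by omega : residueCard L ≠ 0)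
  -- An integral left inverse of AV: undo A, then select the identity block of V.
  have hE : ((1 : Matrix (Fin (m + n)) (Fin (m + n)) (Valued.integer L)).submatrix f id * A⁻¹) *
      (A * V) = 1 := by
    rw [Matrix.mul_assoc, ← Matrix.mul_assoc A⁻¹, Matrix.nonsing_inv_mul _ hA, Matrix.one_mul,
      one_submatrix_mul, hV]
  have hE' := congrArg (fun M : Matrix (Fin i) (Fin i) (Valued.integer L) => M.map ι) hE
  simp only [Matrix.map_mul, Matrix.map_one ι (map_zero ι) (map_one ι)] at hE'
  have h1 := augNorm_le_minorNorm_flow (n := n) hq hϖ t (A.map ι * V.map ι) _ hE' fun x y => by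
    rw [← Matrix.map_mul]
    exact absVal_coe_le_one hq _
  rw [← Matrix.map_mul, Matrix.submatrix_map] at h1
  have h2 := zero_lt_one.trans_le (one_le_augNorm (ϖ := ϖ) ((m + n) * t)
    (((A * V).submatrix (Fin.castAdd n) id).map ι))
  change _ ≤ kernelSize ϖ ((m + n) * t) (((A * V).submatrix (Fin.castAdd n) id).map ι) *
        minorNorm (flow m n ϖ t * (A.map ι * V.map ι))
  rw [kernelSize, div_mul_eq_mul_div, le_div_iff₀ h2]
  calc _ ≤ (residueCard L : ℝ≥0) ^ (n * t * i) * ((residueCard L : ℝ≥0) ^ (m * t * i) *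
        minorNorm (flow m n ϖ t * (A * V).map ι)) := by gcongr
    _ = _ := by
      rw [← mul_assoc, ← pow_add, Matrix.map_mul]
      congr 2
      ring

lemma rpow_neg_le_of_le_mul {c h z β : ℝ≥0} (hc : c ≠ 0) (hz : c ≤ h * z) :
    (z : ℝ≥0∞) ^ (-(β : ℝ)) ≤ ((h ^ (β : ℝ) * c ^ (-(β : ℝ)) : ℝ≥0) : ℝ≥0∞) := by
  have hz0 : z ≠ 0 := by
    rintro rfl
    exact hc (le_antisymm (by simpa using hz) zero_le)
  rw [← ENNReal.coe_rpow_of_ne_zero hz0, ENNReal.coe_le_coe, NNReal.rpow_neg, NNReal.rpow_neg]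
  have hcβ : c ^ (β : ℝ) ≠ 0 := by simp [NNReal.rpow_eq_zero_iff, hc]
  have hzβ : z ^ (β : ℝ) ≠ 0 := by simp [NNReal.rpow_eq_zero_iff, hz0]
  rw [← div_eq_mul_inv, le_div_iff₀ (pos_iff_ne_zero.2 hcβ), inv_mul_le_iff₀ (pos_iff_ne_zero.2 hzβ),
    mul_comm, ← NNReal.mul_rpow]
  exact NNReal.rpow_le_rpow hz β.2

end Integral

/-! ### Averaging over translates and the integral bound. -/

section MainBound

variable {L : Type*} [Field L] [Valued L ℤᵐ⁰]

/-- Since (s+i)/i ≤ s+1 and K ≥ 1, the fractional moment is dominated by the integral one that the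
recursion controls. -/
lemma rpow_div_le_pow {s i : ℕ} (hi : 1 ≤ i) {K : ℝ≥0} (hK : 1 ≤ K) :
    K ^ ((((s + i : ℕ) : ℝ≥0) / (i : ℝ≥0) : ℝ≥0) : ℝ) ≤ K ^ (s + 1) := by
  rw [← NNReal.rpow_natCast]
  refine NNReal.rpow_le_rpow_of_exponent_le hK ?_
  have h1 : (((s + i : ℕ) : ℝ≥0) / (i : ℝ≥0) : ℝ≥0) ≤ ((s + 1 : ℕ) : ℝ≥0) := by
    rw [div_le_iff₀ (by exact_mod_cast hi)]
    have : s + i ≤ (s + 1) * i := by nlinarith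
    exact_mod_cast this
  exact_mod_cast h1

lemma pow_mul_rpow_neg {q z : ℝ≥0} (m n t i : ℕ) (hi : 1 ≤ i) :
    (q ^ (n * t * i) * z) ^ (-(((m : ℝ≥0) / (i : ℝ≥0) : ℝ≥0) : ℝ)) =
      q ^ (-((m : ℤ) * (n : ℤ) * (t : ℤ))) * z ^ (-(((m : ℝ≥0) / (i : ℝ≥0) : ℝ≥0) : ℝ)) := by
  have hi0 : (i : ℝ) ≠ 0 := by exact_mod_cast (by omega : i ≠ 0)
  rw [NNReal.mul_rpow, ← NNReal.rpow_natCast q, ← NNReal.rpow_mul, ← NNReal.rpow_intCast]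
  congr 2
  push_cast
  field_simp

/-- Averaging the integrand over the group of invertible matrices over `𝒪 / ϖᵀ`. -/
lemma sum_rpow_minorNorm_le [Fintype (IsLocalRing.ResidueField (Valued.integer L))]
    (hq : 1 < residueCard L) {ϖ : Valued.integer L}
    (hϖ : (Valued.v (ϖ : L) : ℤᵐ⁰) = WithZero.exp (-1)) {s i n t T : ℕ} (hi : 1 ≤ i)
    (hTdef : T = (s + i + n) * t) (hT : T ≠ 0) [Fintype (TruncInt ϖ T)]
    (V : Matrix (Fin (s + i + n)) (Fin i) L) (hV : minorNorm V ≠ 0) (k : SLInt (s + i + n) L)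
    (S : Finset (Matrix (Fin (s + i + n)) (Fin (s + i + n)) (TruncInt ϖ T)))
    (g : Matrix (Fin (s + i + n)) (Fin (s + i + n)) (TruncInt ϖ T) →
      SLInt (s + i + n) L)
    (lift : Matrix (Fin (s + i + n)) (Fin (s + i + n)) (TruncInt ϖ T) →
      Matrix (Fin (s + i + n)) (Fin (s + i + n)) (Valued.integer L))
    (hlift : ∀ A, (lift A).map (Ideal.Quotient.mk _) = A)
    (hdet : ∀ A ∈ S, IsUnit (lift A).det)
    (hg : ∀ A ∈ S, ∀ W : Matrix (Fin (s + i + n)) (Fin i) L,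
      minorNorm (flow (s + i) n (ϖ : L) t * ((lift A).map (fun x => (x : L)) * W)) ≤
        minorNorm (flow (s + i) n (ϖ : L) t * ((g A).toMatrix * W))) :
    ∑ A ∈ S, (minorNorm (flow (s + i) n (ϖ : L) t * ((g A * k).toMatrix * V)) : ℝ≥0∞) ^
        (-((((s + i : ℕ) : ℝ≥0) / (i : ℝ≥0) : ℝ≥0) : ℝ)) ≤
      ((Fintype.card (Matrix (Fin (s + i + n)) (Fin (s + i + n))
          (TruncInt ϖ T)) *
        (momentConst s i * ((T : ℝ≥0) + 1)) *
        ((residueCard L : ℝ≥0) ^ (n * t * i) * minorNorm V) ^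
          (-((((s + i : ℕ) : ℝ≥0) / (i : ℝ≥0) : ℝ≥0) : ℝ)) : ℝ≥0) : ℝ≥0∞) := by
  set β : ℝ≥0 := ((s + i : ℕ) : ℝ≥0) / (i : ℝ≥0) with hβ
  set c : ℝ≥0 := (residueCard L : ℝ≥0) ^ (n * t * i) * minorNorm V with hc
  have hq0 : (residueCard L : ℝ≥0) ≠ 0 := by exact_mod_cast (by omega : residueCard L ≠ 0)
  have hc0 : c ≠ 0 := mul_ne_zero (pow_ne_zero _ hq0) hV
  have hW0 : minorNorm V ≤ minorNorm (k.toMatrix * V) := minorNorm_le_minorNorm_toMatrix_mul hq k V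
  have hW : minorNorm (k.toMatrix * V) ≠ 0 := ((pos_iff_ne_zero.2 hV).trans_le hW0).ne'
  obtain ⟨V', B, f, hVB, hB, hf, hint⟩ := exists_eq_mul_of_minorNorm_ne_zero hq hW
  let VO : Matrix (Fin (s + i + n)) (Fin i) (Valued.integer L) :=
    Matrix.of fun x j => ⟨V' x j, (absVal_le_one_iff hq).1 (hint x j)⟩
  have hVO : VO.map (fun x => (x : L)) = V' := rfl
  have hVOf : VO.submatrix f id = 1 := by
    ext a b
    have h1 := congrFun (congrFun hf a) b
    refine h1.trans ?_
    rw [Matrix.one_apply, Matrix.one_apply]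
    split_ifs <;> rfl
  let mk := Ideal.Quotient.mk ((Ideal.span {ϖ}) ^ T)
  have hVbar : (VO.map mk).submatrix f id = 1 := by
    rw [Matrix.submatrix_map, hVOf]
    exact Matrix.map_one mk (map_zero mk) (map_one mk)
  have hK : ∀ A ∈ S,
      (minorNorm (flow (s + i) n (ϖ : L) t * ((g A * k).toMatrix * V)) : ℝ≥0∞) ^ (-(β : ℝ)) ≤
      ((truncKernelSize ϖ T T ((A * VO.map mk).submatrix (Fin.castAdd n) id) ^ (s + 1) *
        c ^ (-(β : ℝ)) : ℝ≥0) : ℝ≥0∞) := by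
    intro A hA
    have h1 : (A * VO.map mk).submatrix (Fin.castAdd n) id =
        ((lift A * VO).submatrix (Fin.castAdd n) id).map mk := by
      rw [← Matrix.submatrix_map, Matrix.map_mul, hlift]
    rw [h1, truncKernelSize_mk hϖ hq le_rfl]
    set K := kernelSize (ϖ : L) T
      (((lift A * VO).submatrix (Fin.castAdd n) id).map fun x => (x : L)) with hKdef
    have hK1 : 1 ≤ K := one_le_kernelSize hq hϖ T fun x y => absVal_coe_le_one hq _
    have h2 := pow_mul_minorNorm_le (m := s + i) hq hϖ t (lift A) (hdet A hA) VO f hVOf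
    rw [hVO, ← hTdef, ← hKdef] at h2
    have h3 : c ≤ K * minorNorm (flow (s + i) n (ϖ : L) t * ((g A * k).toMatrix * V)) := by
      calc c ≤ K * minorNorm (flow (s + i) n (ϖ : L) t *
            ((lift A).map (fun x => (x : L)) * V')) * absVal B.det := by
            rw [hc]
            gcongr
            rw [hB]
            exact hW0
        _ = K * minorNorm (flow (s + i) n (ϖ : L) t *
            ((lift A).map (fun x => (x : L)) * (k.toMatrix * V))) := by
            rw [hVB, mul_assoc, ← minorNorm_mul_right hq, Matrix.mul_assoc, Matrix.mul_assoc]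
        _ ≤ K * minorNorm (flow (s + i) n (ϖ : L) t * ((g A).toMatrix * (k.toMatrix * V))) := by
            gcongr
            exact hg A hA _
        _ = _ := by rw [toMatrix_mul, Matrix.mul_assoc]
    refine (rpow_neg_le_of_le_mul hc0 h3).trans ?_
    gcongr
    exact rpow_div_le_pow hi hK1
  refine (Finset.sum_le_sum hK).trans ?_
  rw [← ENNReal.ofNNReal_finsetSum, ENNReal.coe_le_coe, ← Finset.sum_mul]
  gcongr
  -- The terms are nonnegative, so the sum over invertible matrices is enlarged to all matrices,
  -- where the block of first rows is uniform.
  refine (Finset.sum_le_sum_of_subset (Finset.subset_univ S)).trans ?_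
  rw [← Fintype.card_mul_expect,
    expect_mul_right (VO.map mk) f hVbar fun X => truncKernelSize ϖ T T X ^ (s + 1)]
  gcongr
  have h4 := (isKernelSize_truncKernelSize hϖ hq T hT).expect_le s i T le_rfl
  rwa [if_neg (by omega)] at h4

/-- Here m = s + i. The integral is invariant under each translation by `g A`, so |S| times it is at
most the integral of the averaged integrand, bounded pointwise in k by `sum_rpow_minorNorm_le`. -/
theorem lintegral_rpow_wedgeNorm_le {s i n t : ℕ} (hi : 1 ≤ i) (hn : 1 ≤ n) (ht : 1 ≤ t)
    {ϖ : L} (hϖ : (Valued.v ϖ : ℤᵐ⁰) = WithZero.exp (-1))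
    [MeasurableSpace (SLInt (s + i + n) L)] [BorelSpace (SLInt (s + i + n) L)]
    (μ : Measure (SLInt (s + i + n) L)) [μ.IsHaarMeasure] [IsProbabilityMeasure μ]
    (w : Fin i → Fin (s + i + n) → L) :
    ∫⁻ k, (wedgeNorm (wedgeAct i (flow (s + i) n ϖ (t : ℤ) * k.toMatrix)
        (exteriorPower.ιMulti L i w)) : ℝ≥0∞) ^
          (-((((s + i : ℕ) : ℝ≥0) / (i : ℝ≥0) : ℝ≥0) : ℝ)) ∂μ ≤
      ((2 ^ (s + i + n) * momentConst s i * ((s + i + n + 1 : ℕ) : ℝ≥0) * (t : ℝ≥0) *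
        (residueCard L : ℝ≥0) ^ (-(((s + i : ℕ) : ℤ) * (n : ℤ) * (t : ℤ))) : ℝ≥0) : ℝ≥0∞) *
        (wedgeNorm (exteriorPower.ιMulti L i w) : ℝ≥0∞) ^
          (-((((s + i : ℕ) : ℝ≥0) / (i : ℝ≥0) : ℝ≥0) : ℝ)) := by
  classical
  have hfin := finite_residueField (by omega) μ
  have := Fintype.ofFinite (IsLocalRing.ResidueField (Valued.integer L))
  have hq : 1 < residueCard L := Finite.one_lt_card
  have hq0 : (residueCard L : ℝ≥0) ≠ 0 := by exact_mod_cast (by omega : residueCard L ≠ 0)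
  obtain ⟨ϖ, rfl⟩ : ∃ y : Valued.integer L, (y : L) = ϖ := ⟨⟨ϖ, by
    change (Valued.v ϖ : ℤᵐ⁰) ≤ 1
    rw [hϖ, ← WithZero.exp_zero, WithZero.exp_le_exp]
    omega⟩, rfl⟩
  set β : ℝ≥0 := ((s + i : ℕ) : ℝ≥0) / (i : ℝ≥0) with hβ
  have hβ0 : 0 < β := div_pos (by exact_mod_cast (by omega : 0 < s + i)) (by exact_mod_cast hi)
  simp only [wedgeNorm_wedgeAct_ιMulti hq, wedgeNorm_ιMulti hq]
  set V : Matrix (Fin (s + i + n)) (Fin i) L := Matrix.of fun r j => w j r with hVdef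
  have hM : momentConst s i ≠ 0 := by
    cases i with
    | zero => omega
    | succ i => simp [momentConst]
  -- For v = 0 the right side is a nonzero constant times ∞.
  by_cases hV : minorNorm V = 0
  · rw [hV, ENNReal.coe_zero, ENNReal.zero_rpow_of_neg (by simpa using hβ0), ENNReal.mul_top]
    · exact le_top
    · have ht0 : (t : ℝ≥0) ≠ 0 := by exact_mod_cast (by omega : t ≠ 0)
      have hs0 : ((s + i + n + 1 : ℕ) : ℝ≥0) ≠ 0 := Nat.cast_ne_zero.2 (by omega)
      rw [ENNReal.coe_ne_zero]
      exact mul_ne_zero (mul_ne_zero (mul_ne_zero (mul_ne_zero (by positivity) hM) hs0) ht0)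
        (zpow_ne_zero _ hq0)
  have hT : (s + i + n) * t ≠ 0 := mul_ne_zero (by omega) (by omega)
  set T := (s + i + n) * t with hTdef
  have := finite_truncInt hϖ T
  have := Fintype.ofFinite (TruncInt ϖ T)
  let red := truncResidue hϖ T hT
  let S := Finset.univ.filter fun A : Matrix (Fin (s + i + n)) (Fin (s + i + n)) (TruncInt ϖ T) =>
    red A.det ≠ 0
  let lift : Matrix (Fin (s + i + n)) (Fin (s + i + n)) (TruncInt ϖ T) →
      Matrix (Fin (s + i + n)) (Fin (s + i + n)) (Valued.integer L) := fun A =>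
    A.map (Function.surjInv Ideal.Quotient.mk_surjective)
  have hlift : ∀ A, (lift A).map (Ideal.Quotient.mk _) = A := fun A => by
    ext x y
    exact Function.surjInv_eq Ideal.Quotient.mk_surjective _
  have hdet : ∀ A ∈ S, IsUnit (lift A).det := fun A hA => by
    have h1 : red A.det ≠ 0 := (Finset.mem_filter.1 hA).2
    by_contra hc
    apply h1
    have h2 : A.det = Ideal.Quotient.mk _ (lift A).det := by
      rw [RingHom.map_det]
      exact congrArg Matrix.det (hlift A).symm
    rw [h2]
    exact (IsLocalRing.residue_eq_zero_iff _).2 hc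
  have hg : ∀ A, ∃ g : SLInt (s + i + n) L, A ∈ S → ∀ W : Matrix (Fin (s + i + n)) (Fin i) L,
      minorNorm (flow (s + i) n (ϖ : L) t * ((lift A).map (fun x => (x : L)) * W)) ≤
        minorNorm (flow (s + i) n (ϖ : L) t * (g.toMatrix * W)) := fun A => by
    by_cases hA : A ∈ S
    · obtain ⟨g, hg⟩ := exists_SLInt_minorNorm_le (m := s + i) (n := n) (i := i) hq (by omega)
        (ϖ : L) t (lift A) (hdet A hA)
      exact ⟨g, fun _ => hg⟩
    · exact ⟨1, fun h => absurd h hA⟩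
  choose g hg using hg
  set I := ∫⁻ k, (minorNorm (flow (s + i) n (ϖ : L) (t : ℤ) * SLInt.toMatrix k * V) : ℝ≥0∞) ^
    (-(β : ℝ)) ∂μ with hI
  set X : ℝ≥0 := momentConst s i * ((T : ℝ≥0) + 1) *
    ((residueCard L : ℝ≥0) ^ (n * t * i) * minorNorm V) ^ (-(β : ℝ)) with hX
  have hinv : ∀ A, ∫⁻ k, (minorNorm (flow (s + i) n (ϖ : L) (t : ℤ) *
      ((g A * k).toMatrix * V)) : ℝ≥0∞) ^ (-(β : ℝ)) ∂μ = I := fun A => by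
    rw [hI]
    simp only [Matrix.mul_assoc]
    exact lintegral_mul_left_eq_self (μ := μ) (fun k => (minorNorm (flow (s + i) n (ϖ : L) (t : ℤ) *
      (SLInt.toMatrix k * V)) : ℝ≥0∞) ^ (-(β : ℝ))) (g A)
  have h1 : (S.card : ℝ≥0∞) * I ≤
      ((Fintype.card (Matrix (Fin (s + i + n)) (Fin (s + i + n)) (TruncInt ϖ T)) * X : ℝ≥0) :
        ℝ≥0∞) := by
    calc (S.card : ℝ≥0∞) * I = ∑ A ∈ S, ∫⁻ k, (minorNorm (flow (s + i) n (ϖ : L) (t : ℤ) *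
          ((g A * k).toMatrix * V)) : ℝ≥0∞) ^ (-(β : ℝ)) ∂μ := by
          simp only [hinv, Finset.sum_const, nsmul_eq_mul]
      _ ≤ ∫⁻ k, ∑ A ∈ S, (minorNorm (flow (s + i) n (ϖ : L) (t : ℤ) *
          ((g A * k).toMatrix * V)) : ℝ≥0∞) ^ (-(β : ℝ)) ∂μ := sum_lintegral_le μ S _
      _ ≤ ∫⁻ _k, ((Fintype.card (Matrix (Fin (s + i + n)) (Fin (s + i + n)) (TruncInt ϖ T)) * X :
          ℝ≥0) : ℝ≥0∞) ∂μ := lintegral_mono fun k => by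
            refine (sum_rpow_minorNorm_le hq hϖ hi hTdef hT V hV k S g lift hlift hdet hg).trans_eq ?_
            rw [hX, mul_assoc, mul_assoc, mul_assoc]
      _ = _ := by simp
  have hcard := card_le_card_det_ne_zero red
    (isKernelSize_truncKernelSize hϖ hq T hT).surj (s + i + n)
  have hS0 : (S.card : ℝ≥0∞) ≠ 0 := by
    intro h0
    have h0' : S.card = 0 := by exact_mod_cast h0
    have h2 : (Fintype.card (Matrix (Fin (s + i + n)) (Fin (s + i + n)) (TruncInt ϖ T)) : ℝ≥0) ≤
        2 ^ (s + i + n) * (S.card : ℝ≥0) := hcard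
    rw [h0', Nat.cast_zero, mul_zero] at h2
    have h3 : (Fintype.card (Matrix (Fin (s + i + n)) (Fin (s + i + n)) (TruncInt ϖ T)) : ℝ≥0) ≠ 0 :=
      by exact_mod_cast Fintype.card_ne_zero
    exact h3 (le_antisymm h2 zero_le)
  -- The density bound trades the number of all matrices for 2ᵈ |S|, after which |S| cancels.
  have h2 : (S.card : ℝ≥0∞) * I ≤ S.card * ((2 ^ (s + i + n) * X : ℝ≥0) : ℝ≥0∞) := by
    refine h1.trans ?_
    rw [← ENNReal.coe_natCast, ← ENNReal.coe_mul, ENNReal.coe_le_coe]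
    calc _ ≤ 2 ^ (s + i + n) * (S.card : ℝ≥0) * X := by gcongr
      _ = _ := by ring
  have h3 : I ≤ ((2 ^ (s + i + n) * X : ℝ≥0) : ℝ≥0∞) :=
    (ENNReal.mul_le_mul_iff_right hS0 (ENNReal.natCast_ne_top _)).1 h2
  refine h3.trans ?_
  rw [← ENNReal.coe_rpow_of_ne_zero hV, ← ENNReal.coe_mul, ENNReal.coe_le_coe, hX,
    hβ, pow_mul_rpow_neg _ _ _ _ hi]
  have hT1 : (T : ℝ≥0) + 1 ≤ ((s + i + n + 1 : ℕ) : ℝ≥0) * t := by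
    have : T + 1 ≤ (s + i + n + 1) * t := by rw [hTdef]; nlinarith
    exact_mod_cast this
  calc _ = 2 ^ (s + i + n) * momentConst s i * ((T : ℝ≥0) + 1) *
        (residueCard L : ℝ≥0) ^ (-(((s + i : ℕ) : ℤ) * (n : ℤ) * (t : ℤ))) *
        minorNorm V ^ (-((((s + i : ℕ) : ℝ≥0) / (i : ℝ≥0) : ℝ≥0) : ℝ)) := by ring
    _ ≤ 2 ^ (s + i + n) * momentConst s i * (((s + i + n + 1 : ℕ) : ℝ≥0) * t) *
        (residueCard L : ℝ≥0) ^ (-(((s + i : ℕ) : ℤ) * (n : ℤ) * (t : ℤ))) *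
        minorNorm V ^ (-((((s + i : ℕ) : ℝ≥0) / (i : ℝ≥0) : ℝ≥0) : ℝ)) := by gcongr
    _ = _ := by ring

end MainBound

end NonarchWedge

end

theorem proposition3p6 (m n : ℕ) (hm : 1 ≤ m) (hn : 1 ≤ n) :
    ∃ C : ℝ≥0, 0 < C ∧
      -- `K` is a global function field over the finite field `Fq`
      ∀ (Fq : Type*) [Field Fq] [Finite Fq]
        (K : Type*) [Field K] [Algebra (RatFunc Fq) K] [FunctionField Fq K]
        -- `ν` is a normalized discrete valuation on `K`, with uniformizer `ϖ`
        (ν : Valuation K ℤᵐ⁰) (_ : Function.Surjective ν)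
        (ϖ : K) (_ : ν ϖ = WithZero.exp (-1))
        -- `haar` is the normalized Haar measure on `SL_{m+n}(𝒪_ν)`
        [MeasurableSpace (NonarchWedge.SLInt (m + n) ν.Completion)]
        [BorelSpace (NonarchWedge.SLInt (m + n) ν.Completion)]
        (haar : MeasureTheory.Measure (NonarchWedge.SLInt (m + n) ν.Completion))
        [haar.IsHaarMeasure] [MeasureTheory.IsProbabilityMeasure haar]
        (i : ℕ) (_ : 1 ≤ i) (_ : i ≤ m) (t : ℕ) (_ : 1 ≤ t)
        (v : ⋀[ν.Completion]^i (Fin (m + n) → ν.Completion))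
        (_ : NonarchWedge.IsDecomposable v),
        ∫⁻ k, (NonarchWedge.wedgeNorm (NonarchWedge.wedgeAct i
              (NonarchWedge.flow m n (ϖ : ν.Completion) (t : ℤ) * k.toMatrix) v) : ℝ≥0∞)
            ^ (-((m : ℝ) / (i : ℝ))) ∂haar
          ≤ ((C * (t : ℝ≥0) * (NonarchWedge.residueCard ν.Completion : ℝ≥0)
              ^ (-((m : ℤ) * (n : ℤ) * (t : ℤ))) : ℝ≥0) : ℝ≥0∞)
            * (NonarchWedge.wedgeNorm v : ℝ≥0∞) ^ (-((m : ℝ) / (i : ℝ))) := by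
  -- Summing `momentConst (m - i) i` over i makes the constant uniform in i; the added 1 gives
  -- positivity, and m+n+1 comes from T + 1 ≤ (m+n+1)t.
  refine ⟨2 ^ (m + n) * (1 + ∑ i ∈ Finset.range (m + 1), NonarchWedge.momentConst (m - i) i) *
    ((m + n + 1 : ℕ) : ℝ≥0), by positivity, ?_⟩
  intro Fq _ _ K _ _ _ ν _ ϖ hϖ _ _ haar _ _ i hi him t ht v hv
  obtain ⟨w, rfl⟩ := hv
  have hC : NonarchWedge.momentConst (m - i) i ≤
      1 + ∑ i ∈ Finset.range (m + 1), NonarchWedge.momentConst (m - i) i :=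
    le_add_left (Finset.single_le_sum (f := fun i => NonarchWedge.momentConst (m - i) i)
      (fun _ _ => zero_le) (Finset.mem_range.2 (by omega)))
  generalize 1 + ∑ i ∈ Finset.range (m + 1), NonarchWedge.momentConst (m - i) i = C at hC ⊢
  obtain ⟨s, rfl⟩ := Nat.exists_eq_add_of_le' him
  rw [Nat.add_sub_cancel] at hC
  have hϖ' : Valued.v (ϖ : ν.Completion) = WithZero.exp (-1 : ℤ) :=
    (Valued.valuedCompletion_apply _).trans hϖ
  have hβ : (((s + i : ℕ) : ℝ) / (i : ℝ)) =
      ((((s + i : ℕ) : ℝ≥0) / (i : ℝ≥0) : ℝ≥0) : ℝ) := by push_cast; rfl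
  rw [hβ]
  refine (NonarchWedge.lintegral_rpow_wedgeNorm_le hi hn ht hϖ' haar w).trans ?_
  gcongr
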